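/- Let $\mathcal B$ be a Krull–Schmidt exact category (for instance linear over a field) with enough projectives and enough injectives, and let $\mathcal P$, $\mathcal I$ be its subcategories of projective and injective objects. All subcategories are full and closed under isomorphisms. $X\rightarrowtail Y\twoheadrightarrow Z$ denotes a short exact sequence of $\mathcal B$, and $\mathrm{Ext}^1(\mathcal U,\mathcal V)=0$ means that every $V\rightarrowtail Y\twoheadrightarrow U$ with $U\in\mathcal U$, $V\in\mathcal V$ splits. A cotorsion pair $(\mathcal U,\mathcal V)$ consists of two subcategories closed under direct summands such that $\mathrm{Ext}^1(\mathcal U,\mathcal V)=0$ and every object $B$ admits short exact sequences $V_B\rightarrowtail U_B\twoheadrightarrow B$ and $B\rightarrowtail V^B\twoheadrightarrow U^B$ with $U_B,U^B\in\mathcal U$ and $V_B,V^B\in\mathcal V$. Let $\mathcal H$ be the subcategory of those $B$ for which such sequences exist with moreover $U_B,V^B\in\mathcal U\cap\mathcal V$. For subcategories $\mathcal W,\mathcal R$ let $\mathcal W_{\mathcal R}$ be the subcategory of the objects of $\mathcal W$ that have no nonzero direct summand in $\mathcal R$. Let $(\mathcal C,\mathcal K)$ be a fully rigid cotorsion pair,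 that is: $\mathrm{Ext}^1(\mathcal C,\mathcal C)=0$; $\mathcal C_{\mathcal P}\neq 0$; and every indecomposable object of $\mathcal B$ lies in $\mathcal K$ or in $\mathcal H$, where $\mathcal H$ is formed for $(\mathcal C,\mathcal K)$. Assume that $(\mathcal K,\mathcal D)$ is also a cotorsion pair. Let $\overline{\mathcal B}=\mathcal B/\mathcal K$ be the quotient of $\mathcal B$ by the ideal of morphisms that factor through an object of $\mathcal K$, and write $\overline f$ for the image of $f$ in $\overline{\mathcal B}$. For $f:X\to Y$ choose $\Omega X\rightarrowtail P_X\twoheadrightarrow X$ and $\Omega Y\rightarrowtail P_Y\twoheadrightarrow Y$ with $P_X,P_Y\in\mathcal P$, and let $\Omega f:\Omega X\to\Omega Y$ be the morphism induced by a lift $P_X\to P_Y$ of $f$. Dually, choose $X\rightarrowtail I_X\twoheadrightarrow\Sigma X$ and $Y\rightarrowtail I_Y\twoheadrightarrow\Sigma Y$ with $I_X,I_Y\in\mathcal I$, and let $\Sigma f:\Sigma X\to\Sigma Y$ be induced by an extension $I_X\to I_Y$ of $f$. Here $\mathrm{pd}_{\overline{\mathcal B}}X\le n$ (resp. $\mathrm{id}_{\overline{\mathcal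 B}}X\le n$) means that $X$ has a projective (resp. injective) resolution of length at most $n$ in $\overline{\mathcal B}$. Let $X\in\mathcal H_{\mathcal K}$. (a) There is a short exact sequence $X\overset{x}{\rightarrowtail}C^1\twoheadrightarrow C^2$ with $C^1,C^2\in\mathcal C$, and for every such sequence (and all choices made for $\Omega x$): $\mathrm{pd}_{\overline{\mathcal B}}X\le 1$ if and only if $\overline{\Omega x}=0$. (b) There is a short exact sequence $D_2\rightarrowtail D_1\overset{y}{\twoheadrightarrow}X$ with $D_1,D_2\in\mathcal D$, and for every such sequence (and all choices made for $\Sigma y$): $\mathrm{id}_{\overline{\mathcal B}}X\le 1$ if and only if $\overline{\Sigma y}=0$. -/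

import Mathlib

open CategoryTheory CategoryTheory.Limits

universe v u

attribute [local instance] hasBinaryBiproducts_of_finite_biproducts

/-! ### Exact categories -/

section WeakShortExact

variable {A : Type u} [Category.{v} A] [HasZeroMorphisms A]

/-- `(i, d)` is a weak short exact sequence (kernel-cokernel pair): `i` is a kernel of `d` and
`d` is a cokernel of `i`. In an abelian category this says that `0 ⟶ X ⟶ Y ⟶ Z ⟶ 0` is exact. -/
def IsWeakShortExact {X Y Z : A} (i : X ⟶ Y) (d : Y ⟶ Z) : Prop :=
  ∃ w : i ≫ d = 0, Nonempty (IsLimit (KernelFork.ofι i w)) ∧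
    Nonempty (IsColimit (CokernelCofork.ofπ d w))

end WeakShortExact

/-- A class of composable pairs of morphisms, to be thought of as "short exact sequences". -/
abbrev PairClass (B : Type u) [Category.{v} B] :=
  ∀ ⦃X Y Z : B⦄, (X ⟶ Y) → (Y ⟶ Z) → Prop

/-- Inflations: first morphisms of the pairs in the class. -/
def PairClass.IsInflation {B : Type u} [Category.{v} B] (ses : PairClass B)
    {X Y : B} (i : X ⟶ Y) : Prop :=
  ∃ (Z : B) (d : Y ⟶ Z), ses i d

/-- Deflations: second morphisms of the pairs in the class. -/
def PairClass.IsDeflation {B : Type u} [Category.{v} B] (ses : PairClass B)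
    {Y Z : B} (d : Y ⟶ Z) : Prop :=
  ∃ (X : B) (i : X ⟶ Y), ses i d

/-- An exact structure (in the sense of Quillen) on an additive category. -/
structure ExactStructure (B : Type u) [Category.{v} B] [Preadditive B]
    [HasFiniteBiproducts B] where
  /-- `ses i d` means that `X ↣ Y ↠ Z` is a short exact sequence of the exact structure. -/
  ses : PairClass B
  weak : ∀ {X Y Z : B} {i : X ⟶ Y} {d : Y ⟶ Z}, ses i d → IsWeakShortExact i d
  ses_of_iso : ∀ {X Y Z X' Y' Z' : B} {i : X ⟶ Y} {d : Y ⟶ Z} {i' : X' ⟶ Y'} {d' : Y' ⟶ Z'}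
    (a : X ≅ X') (b : Y ≅ Y') (c : Z ≅ Z'), i ≫ b.hom = a.hom ≫ i' → d ≫ c.hom = b.hom ≫ d' →
    ses i d → ses i' d'
  ses_biprod : ∀ {X Y Z X' Y' Z' : B} {i : X ⟶ Y} {d : Y ⟶ Z} {i' : X' ⟶ Y'} {d' : Y' ⟶ Z'},
    ses i d → ses i' d' → ses (biprod.map i i') (biprod.map d d')
  ses_of_biprod : ∀ {X Y Z X' Y' Z' : B} {i : X ⟶ Y} {d : Y ⟶ Z} {i' : X' ⟶ Y'} {d' : Y' ⟶ Z'},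
    ses (biprod.map i i') (biprod.map d d') → ses i d
  id_inflation : ∀ X : B, ses.IsInflation (𝟙 X)
  id_deflation : ∀ X : B, ses.IsDeflation (𝟙 X)
  comp_inflation : ∀ {X Y Z : B} (f : X ⟶ Y) (g : Y ⟶ Z),
    ses.IsInflation f → ses.IsInflation g → ses.IsInflation (f ≫ g)
  comp_deflation : ∀ {X Y Z : B} (f : X ⟶ Y) (g : Y ⟶ Z),
    ses.IsDeflation f → ses.IsDeflation g → ses.IsDeflation (f ≫ g)
  exists_pullback : ∀ {X Y Z Z' : B} {i : X ⟶ Y} {d : Y ⟶ Z} (f : Z' ⟶ Z), ses i d →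
    ∃ (Y' : B) (f' : Y' ⟶ Y) (d' : Y' ⟶ Z'), IsPullback f' d' d f ∧ ses.IsDeflation d'
  exists_pushout : ∀ {X Y Z X' : B} {i : X ⟶ Y} {d : Y ⟶ Z} (g : X ⟶ X'), ses i d →
    ∃ (Y' : B) (g' : Y ⟶ Y') (i' : X' ⟶ Y'), IsPushout i g g' i' ∧ ses.IsInflation i'

/-- A Krull-Schmidt category: every object is a finite direct sum of objects with local
endomorphism rings. -/
def IsKrullSchmidt (B : Type u) [Category.{v} B] [Preadditive B] [HasFiniteBiproducts B] : Prop :=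
  ∀ X : B, ∃ (n : ℕ) (F : Fin n → B), (∀ j, IsLocalRing (End (F j))) ∧ Nonempty (X ≅ ⨁ F)

/-- The objects of `W` that have no nonzero direct summand in `R` (so zero objects of `W` are
included). In a Krull-Schmidt category idempotents split, hence a direct summand of `X` is the
same thing as a retract of `X`. -/
def noSummandIn {B : Type u} [Category.{v} B] [HasZeroMorphisms B]
    (W R : ObjectProperty B) : ObjectProperty B :=
  fun X => W X ∧ ∀ Z : B, Nonempty (Retract Z X) → R Z → IsZero Z

namespace ExactStructure

variable {B : Type u} [Category.{v} B] [Preadditive B] [HasFiniteBiproducts B]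
  (E : ExactStructure B)

/-- The projective objects of the exact category. -/
def proj : ObjectProperty B :=
  fun P => ∀ ⦃Y Z : B⦄ (d : Y ⟶ Z), E.ses.IsDeflation d → ∀ f : P ⟶ Z, ∃ g : P ⟶ Y, g ≫ d = f

/-- The injective objects of the exact category. -/
def inj : ObjectProperty B :=
  fun I => ∀ ⦃X Y : B⦄ (i : X ⟶ Y), E.ses.IsInflation i → ∀ f : X ⟶ I, ∃ g : Y ⟶ I, i ≫ g = f

def EnoughProjectives : Prop :=
  ∀ X : B, ∃ (P : B) (d : P ⟶ X), E.proj P ∧ E.ses.IsDeflation d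

def EnoughInjectives : Prop :=
  ∀ X : B, ∃ (I : B) (i : X ⟶ I), E.inj I ∧ E.ses.IsInflation i

/-- `Ext¹(U, V) = 0` for all `U` in `𝒰` and `V` in `𝒱`: every short exact sequence
`V ↣ Y ↠ U` splits. -/
def Ext1Vanishes (𝒰 𝒱 : ObjectProperty B) : Prop :=
  ∀ ⦃V Y U : B⦄ (i : V ⟶ Y) (d : Y ⟶ U), 𝒱 V → 𝒰 U → E.ses i d → ∃ s : U ⟶ Y, s ≫ d = 𝟙 U

/-- A subcategory is rigid if it has no self-extensions. -/
def IsRigid (𝒞 : ObjectProperty B) : Prop := E.Ext1Vanishes 𝒞 𝒞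

/-- Cotorsion pairs. (Stability under retracts is closure under isomorphisms and
direct summands.) -/
structure IsCotorsionPair (𝒰 𝒱 : ObjectProperty B) : Prop where
  left_summands : 𝒰.IsStableUnderRetracts
  right_summands : 𝒱.IsStableUnderRetracts
  ext : E.Ext1Vanishes 𝒰 𝒱
  left_approx : ∀ X : B, ∃ (V U : B) (i : V ⟶ U) (d : U ⟶ X), 𝒱 V ∧ 𝒰 U ∧ E.ses i d
  right_approx : ∀ X : B, ∃ (V U : B) (i : X ⟶ V) (d : V ⟶ U), 𝒱 V ∧ 𝒰 U ∧ E.ses i d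

/-- The subcategory `ℋ` whose quotient by `𝒰 ∩ 𝒱` is the heart of the cotorsion pair
`(𝒰, 𝒱)`. -/
def heart (𝒰 𝒱 : ObjectProperty B) : ObjectProperty B :=
  fun X =>
    (∃ (V U : B) (i : V ⟶ U) (d : U ⟶ X), 𝒱 V ∧ (𝒰 U ∧ 𝒱 U) ∧ E.ses i d) ∧
    (∃ (V U : B) (i : X ⟶ V) (d : V ⟶ U), (𝒰 V ∧ 𝒱 V) ∧ 𝒰 U ∧ E.ses i d)

/-- The cotorsion pair `(𝒞, 𝒦)` is fully rigid. -/
structure IsFullyRigid (𝒞 𝒦 : ObjectProperty B) : Prop where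
  rigid : E.IsRigid 𝒞
  cotorsion : E.IsCotorsionPair 𝒞 𝒦
  exists_nonprojective : ∃ X : B, noSummandIn 𝒞 E.proj X ∧ ¬ IsZero X
  indecomposable : ∀ X : B, Indecomposable X → 𝒦 X ∨ E.heart 𝒞 𝒦 X

/-! ### The syzygy of a morphism -/

/-- A short exact sequence `ΩX ↣ P ↠ X` with `P` projective. -/
structure ProjPres (X : B) where
  syz : B
  P : B
  ι : syz ⟶ P
  π : P ⟶ X
  projective : E.proj P
  ses : E.ses ι π

/-- A short exact sequence `X ↣ I ↠ ΣX` with `I` injective. -/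
structure InjPres (X : B) where
  I : B
  cosyz : B
  ι : X ⟶ I
  π : I ⟶ cosyz
  injective : E.inj I
  ses : E.ses ι π

variable {E}

/-- `a : ΩX ⟶ ΩY` represents `Ωf`: it is induced by a lift `b` of `f : X ⟶ Y` to the
projective presentations. It exists and is unique modulo morphisms factoring through a
projective, see the lemmas below. -/
def ProjPres.Represents {X Y : B} (p : E.ProjPres X) (q : E.ProjPres Y) (f : X ⟶ Y)
    (a : p.syz ⟶ q.syz) : Prop :=
  ∃ b : p.P ⟶ q.P, a ≫ q.ι = p.ι ≫ b ∧ b ≫ q.π = p.π ≫ f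

/-- `c : ΣX ⟶ ΣY` represents `Σf`: it is induced by an extension `b` of `f : X ⟶ Y` to the
injective presentations. -/
def InjPres.Represents {X Y : B} (p : E.InjPres X) (q : E.InjPres Y) (f : X ⟶ Y)
    (c : p.cosyz ⟶ q.cosyz) : Prop :=
  ∃ b : p.I ⟶ q.I, p.ι ≫ b = f ≫ q.ι ∧ p.π ≫ c = b ≫ q.π

lemma ProjPres.exists_represents {X Y : B} (p : E.ProjPres X) (q : E.ProjPres Y) (f : X ⟶ Y) :
    ∃ a, p.Represents q f a := by
  obtain ⟨b, hb⟩ := p.projective q.π ⟨_, _, q.ses⟩ (p.π ≫ f)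
  obtain ⟨wp, -, -⟩ := E.weak p.ses
  obtain ⟨wq, ⟨hq⟩, -⟩ := E.weak q.ses
  refine ⟨hq.lift (KernelFork.ofι (p.ι ≫ b) ?_), b, ?_, hb⟩
  · rw [Category.assoc, hb, reassoc_of% wp, zero_comp]
  · exact hq.fac _ WalkingParallelPair.zero

lemma ProjPres.Represents.sub_factors {X Y : B} {p : E.ProjPres X} {q : E.ProjPres Y}
    {f : X ⟶ Y} {a a' : p.syz ⟶ q.syz} (h : p.Represents q f a) (h' : p.Represents q f a') :
    ∃ t : p.P ⟶ q.syz, a - a' = p.ι ≫ t := by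
  obtain ⟨b, h1, h2⟩ := h
  obtain ⟨b', h1', h2'⟩ := h'
  obtain ⟨wq, ⟨hq⟩, -⟩ := E.weak q.ses
  refine ⟨hq.lift (KernelFork.ofι (b - b') ?_), ?_⟩
  · rw [Preadditive.sub_comp, h2, h2', sub_self]
  · apply Fork.IsLimit.hom_ext hq
    have := hq.fac (KernelFork.ofι (b - b') (by rw [Preadditive.sub_comp, h2, h2', sub_self]))
      WalkingParallelPair.zero
    simp only [Fork.ofι_π_app] at this
    simp [Preadditive.sub_comp, h1, h1', this]

lemma InjPres.exists_represents {X Y : B} (p : E.InjPres X) (q : E.InjPres Y) (f : X ⟶ Y) :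
    ∃ c, p.Represents q f c := by
  obtain ⟨b, hb⟩ := q.injective p.ι ⟨_, _, p.ses⟩ (f ≫ q.ι)
  obtain ⟨wp, -, ⟨hp⟩⟩ := E.weak p.ses
  obtain ⟨wq, -, -⟩ := E.weak q.ses
  refine ⟨hp.desc (CokernelCofork.ofπ (b ≫ q.π) ?_), b, hb, ?_⟩
  · rw [reassoc_of% hb, wq, comp_zero]
  · exact hp.fac _ WalkingParallelPair.one

lemma InjPres.Represents.sub_factors {X Y : B} {p : E.InjPres X} {q : E.InjPres Y}
    {f : X ⟶ Y} {c c' : p.cosyz ⟶ q.cosyz} (h : p.Represents q f c) (h' : p.Represents q f c') :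
    ∃ t : p.cosyz ⟶ q.I, c - c' = t ≫ q.π := by
  obtain ⟨b, h1, h2⟩ := h
  obtain ⟨b', h1', h2'⟩ := h'
  obtain ⟨wp, -, ⟨hp⟩⟩ := E.weak p.ses
  refine ⟨hp.desc (CokernelCofork.ofπ (b - b') ?_), ?_⟩
  · rw [Preadditive.comp_sub, h1, h1', sub_self]
  · apply Cofork.IsColimit.hom_ext hp
    have := hp.fac (CokernelCofork.ofπ (b - b') (by rw [Preadditive.comp_sub, h1, h1', sub_self]))
      WalkingParallelPair.one
    simp only [Cofork.ofπ_ι_app] at this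
    simp [Preadditive.comp_sub, h2, h2', reassoc_of% this]

end ExactStructure

/-! ### The quotient of an additive category by a subcategory -/

section IdealQuotient

variable {B : Type u} [Category.{v} B] [Preadditive B]

/-- The morphisms `X ⟶ Y` that factor through an object of `W`. -/
def factorSet (W : ObjectProperty B) (X Y : B) : Set (X ⟶ Y) :=
  {h | ∃ (Z : B) (a : X ⟶ Z) (b : Z ⟶ Y), W Z ∧ a ≫ b = h}

/-- The subgroup generated by the morphisms `X ⟶ Y` that factor through an object of `W`. When
`W` is nonempty and closed under direct sums it consists of these morphisms, see `mem_factorIdeal`. -/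
def factorIdeal (W : ObjectProperty B) (X Y : B) : AddSubgroup (X ⟶ Y) :=
  AddSubgroup.closure (factorSet W X Y)

lemma mem_factorIdeal [HasFiniteBiproducts B] (W : ObjectProperty B) (h0 : ∃ Z, W Z)
    (h2 : ∀ Z Z' : B, W Z → W Z' → W (Z ⊞ Z')) {X Y : B} (f : X ⟶ Y) :
    f ∈ factorIdeal W X Y ↔ f ∈ factorSet W X Y := by
  refine ⟨fun hf => ?_, fun hf => AddSubgroup.subset_closure hf⟩
  refine AddSubgroup.closure_induction (fun _ h => h) ⟨h0.choose, 0, 0, h0.choose_spec, by simp⟩ ?_ ?_ hf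
  · rintro _ _ - - ⟨Z, a, b, hZ, rfl⟩ ⟨Z', a', b', hZ', rfl⟩
    exact ⟨Z ⊞ Z', biprod.lift a a', biprod.desc b b', h2 _ _ hZ hZ', by simp⟩
  · rintro _ - ⟨Z, a, b, hZ, rfl⟩
    exact ⟨Z, a, -b, hZ, by simp⟩

/-- Two morphisms are identified if their difference lies in the ideal of `W`. -/
def factorRel (W : ObjectProperty B) : HomRel B :=
  fun X Y f g => f - g ∈ factorIdeal W X Y

lemma factorIdeal_comp (W : ObjectProperty B) {X Y Z : B} (g : Y ⟶ Z) {f : X ⟶ Y}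
    (hf : f ∈ factorIdeal W X Y) : f ≫ g ∈ factorIdeal W X Z := by
  refine AddSubgroup.closure_induction
    (p := fun f _ => f ≫ g ∈ factorIdeal W X Z) ?_ ?_ ?_ ?_ hf
  · rintro _ ⟨T, a, b, hT, rfl⟩
    exact AddSubgroup.subset_closure ⟨T, a, b ≫ g, hT, by simp⟩
  · simp
  · intro _ _ _ _ h h'
    simpa [Preadditive.add_comp] using add_mem h h'
  · intro _ _ h
    simpa using h

lemma comp_factorIdeal (W : ObjectProperty B) {X Y Z : B} (g : X ⟶ Y) {f : Y ⟶ Z}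
    (hf : f ∈ factorIdeal W Y Z) : g ≫ f ∈ factorIdeal W X Z := by
  refine AddSubgroup.closure_induction
    (p := fun f _ => g ≫ f ∈ factorIdeal W X Z) ?_ ?_ ?_ ?_ hf
  · rintro _ ⟨T, a, b, hT, rfl⟩
    exact AddSubgroup.subset_closure ⟨T, g ≫ a, b, hT, by simp⟩
  · simp
  · intro _ _ _ _ h h'
    simpa [Preadditive.comp_add] using add_mem h h'
  · intro _ _ h
    simpa using h

instance factorRel_congruence (W : ObjectProperty B) : Congruence (factorRel W) where
  equivalence :=
    { refl := fun f => by simp [factorRel]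
      symm := fun {f g} h => by
        have h' := neg_mem h
        rwa [neg_sub] at h'
      trans := fun {f g k} h h' => by
        have h'' := add_mem h h'
        rwa [sub_add_sub_cancel] at h'' }
  comp_left := fun f _ _ h => by
    have h' := comp_factorIdeal W f h
    rwa [Preadditive.comp_sub] at h'
  comp_right := fun g h => by
    have h' := factorIdeal_comp W g h
    rwa [Preadditive.sub_comp] at h'

/-- The quotient category `ℬ/𝒲`: same objects, morphisms modulo the ideal of `𝒲`. -/
abbrev IdealQuotient (W : ObjectProperty B) := CategoryTheory.Quotient (factorRel W)

/-- The quotient functor `ℬ ⥤ ℬ/𝒲`. -/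
abbrev toIdealQuotient (W : ObjectProperty B) : B ⥤ IdealQuotient W :=
  CategoryTheory.Quotient.functor (factorRel W)

instance idealQuotientPreadditive (W : ObjectProperty B) : Preadditive (IdealQuotient W) :=
  CategoryTheory.Quotient.preadditive (factorRel W) (fun _ _ _ _ _ _ h h' => by
    have h'' := add_mem h h'
    rwa [sub_add_sub_comm] at h'')

lemma toIdealQuotient_map_eq_zero_iff (W : ObjectProperty B) {X Y : B} (f : X ⟶ Y) :
    (toIdealQuotient W).map f = 0 ↔ f ∈ factorIdeal W X Y := by
  have h : (toIdealQuotient W).map f = (toIdealQuotient W).map 0 ↔ factorRel W f 0 :=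
    CategoryTheory.Quotient.functor_map_eq_iff (factorRel W) f 0
  simpa [factorRel] using h

end IdealQuotient

/-! ### Projective and injective dimension -/

section Dimension

variable {A : Type u} [Category.{v} A] [HasZeroMorphisms A]

/-- `pd X ≤ n`: there is an exact sequence `0 ⟶ P_n ⟶ ⋯ ⟶ P_0 ⟶ X ⟶ 0` with all `P_i`
projective, cut into short exact sequences. -/
def ProjDimLE : ℕ → A → Prop
  | 0, X => Projective X
  | n + 1, X => ∃ (Y P : A) (i : Y ⟶ P) (d : P ⟶ X),
      IsWeakShortExact i d ∧ Projective P ∧ ProjDimLE n Y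

/-- `id X ≤ n`: there is an exact sequence `0 ⟶ X ⟶ I_0 ⟶ ⋯ ⟶ I_n ⟶ 0` with all `I_j`
injective, cut into short exact sequences. -/
def InjDimLE : ℕ → A → Prop
  | 0, X => Injective X
  | n + 1, X => ∃ (I Y : A) (i : X ⟶ I) (d : I ⟶ Y),
      IsWeakShortExact i d ∧ Injective I ∧ InjDimLE n Y

end Dimension

/-! Rigidity gives `𝒞 ⊆ 𝒦`, so `𝒞` and the projectives die in the quotient by `𝒦`. For `C` in `𝒞`, a
morphism `ΩC ⟶ T` dies there exactly when it extends over `ΩC ↣ P`; thus morphisms `ΩC ⟶ T` in the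
quotient are the elements of Ext¹(C, T). Hence `ΩC` becomes projective (`projective_map_syz`), and
`X ↣ C₁ ↠ C₂` yields a projective presentation `ΩC₁ ⟶ ΩC₂ ⟶ X ⟶ 0`. Full rigidity gives every local
object outside `𝒦` such a coresolution, so the quotient can be tested on these syzygies.

A morphism `ΩC ⟶ ΩC₁` killed by `Ωd` has the form `Ω(g ≫ x)` with `g : C ⟶ X`
(`exists_represents_comp`). So if `Ωx` vanishes, `Ωd` is mono and the presentation is a resolution
of length one. Conversely, comparison with a resolution of length one gives an endomorphism `ε = Ω(g
≫ x)` of `ΩC₁` with `Ωx ≫ ε = Ωx`, whence `Ω((1 - x ≫ g) ≫ x) = 0`. As `x ≫ g` factors through `𝒦`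
and `X` has no summand there, `1 - x ≫ g` is invertible, and `Ωx` vanishes.

Part (b) is part (a) in the opposite category for the pair `(𝒟, 𝒦)`. The point to check is that a
`𝒦`-approximation `D ↣ K ↠ X` has `K` in `𝒟` (`IsCoresolving.right_of_approx`). The quotient enters
only through `IsQuotientFunctor`, a notion stable under passing to opposites. -/

/-! ### Kernel-cokernel pairs -/

namespace IsWeakShortExact

variable {A : Type u} [Category.{v} A] [HasZeroMorphisms A] {X Y Z : A} {i : X ⟶ Y} {d : Y ⟶ Z}

lemma zero (h : IsWeakShortExact i d) : i ≫ d = 0 := h.choose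

lemma mono (h : IsWeakShortExact i d) : Mono i := by
  obtain ⟨w, ⟨hi⟩, -⟩ := h
  exact mono_of_isLimit_fork hi

lemma epi (h : IsWeakShortExact i d) : Epi d := by
  obtain ⟨w, -, ⟨hd⟩⟩ := h
  exact epi_of_isColimit_cofork hd

lemma exists_lift (h : IsWeakShortExact i d) {T : A} (f : T ⟶ Y) (hf : f ≫ d = 0) :
    ∃ l : T ⟶ X, l ≫ i = f := by
  obtain ⟨w, ⟨hi⟩, -⟩ := h
  exact ⟨hi.lift (KernelFork.ofι f hf), hi.fac _ WalkingParallelPair.zero⟩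

lemma exists_desc (h : IsWeakShortExact i d) {T : A} (f : Y ⟶ T) (hf : i ≫ f = 0) :
    ∃ l : Z ⟶ T, d ≫ l = f := by
  obtain ⟨w, -, ⟨hd⟩⟩ := h
  exact ⟨hd.desc (CokernelCofork.ofπ f hf), hd.fac _ WalkingParallelPair.one⟩

lemma of_exists_lift_desc (w : i ≫ d = 0) [Mono i] [Epi d]
    (hi : ∀ (T : A) (f : T ⟶ Y), f ≫ d = 0 → ∃ l : T ⟶ X, l ≫ i = f)
    (hd : ∀ (T : A) (f : Y ⟶ T), i ≫ f = 0 → ∃ l : Z ⟶ T, d ≫ l = f) :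
    IsWeakShortExact i d := by
  refine ⟨w, ⟨KernelFork.IsLimit.ofι i w (fun f hf => (hi _ f hf).choose)
    (fun f hf => (hi _ f hf).choose_spec) fun f hf m hm => ?_⟩,
    ⟨CokernelCofork.IsColimit.ofπ d w (fun f hf => (hd _ f hf).choose)
    (fun f hf => (hd _ f hf).choose_spec) fun f hf m hm => ?_⟩⟩
  · rw [← cancel_mono i, hm, (hi _ f hf).choose_spec]
  · rw [← cancel_epi d, hm, (hd _ f hf).choose_spec]

lemma op (h : IsWeakShortExact i d) : IsWeakShortExact d.op i.op := by
  have := h.mono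
  have := h.epi
  refine of_exists_lift_desc (by rw [← op_comp, h.zero, op_zero]) (fun T f hf => ?_)
    fun T f hf => ?_
  · obtain ⟨l, hl⟩ := h.exists_desc f.unop (by rw [← Quiver.Hom.unop_op i, ← unop_comp, hf]; rfl)
    exact ⟨l.op, Quiver.Hom.unop_inj hl⟩
  · obtain ⟨l, hl⟩ := h.exists_lift f.unop (by rw [← Quiver.Hom.unop_op d, ← unop_comp, hf]; rfl)
    exact ⟨l.op, Quiver.Hom.unop_inj hl⟩

lemma unop {X Y Z : Aᵒᵖ} {i : X ⟶ Y} {d : Y ⟶ Z} (h : IsWeakShortExact i d) :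
    IsWeakShortExact d.unop i.unop := by
  have := h.mono
  have := h.epi
  refine of_exists_lift_desc (by rw [← unop_comp, h.zero, unop_zero]) (fun T f hf => ?_)
    fun T f hf => ?_
  · obtain ⟨l, hl⟩ := h.exists_desc f.op (by rw [← Quiver.Hom.op_unop i, ← op_comp, hf]; rfl)
    exact ⟨l.unop, Quiver.Hom.op_inj hl⟩
  · obtain ⟨l, hl⟩ := h.exists_lift f.op (by rw [← Quiver.Hom.op_unop d, ← op_comp, hf]; rfl)
    exact ⟨l.unop, Quiver.Hom.op_inj hl⟩

end IsWeakShortExact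

section Splitting

variable {A : Type u} [Category.{v} A] [Preadditive A] {X Y Z : A} {i : X ⟶ Y} {d : Y ⟶ Z}

namespace IsWeakShortExact

lemma exists_retraction (h : IsWeakShortExact i d)
    (s : Z ⟶ Y) (hs : s ≫ d = 𝟙 Z) : ∃ r : Y ⟶ X, i ≫ r = 𝟙 X := by
  have := h.mono
  obtain ⟨r, hr⟩ := h.exists_lift (𝟙 Y - d ≫ s)
    (by rw [Preadditive.sub_comp, Category.assoc, hs]; simp)
  refine ⟨r, ?_⟩
  rw [← cancel_mono i, Category.assoc, hr, Preadditive.comp_sub, reassoc_of% h.zero]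
  simp

lemma exists_section (h : IsWeakShortExact i d)
    (r : Y ⟶ X) (hr : i ≫ r = 𝟙 X) : ∃ s : Z ⟶ Y, s ≫ d = 𝟙 Z := by
  have := h.epi
  obtain ⟨s, hs⟩ := h.exists_desc (𝟙 Y - r ≫ i)
    (by rw [Preadditive.comp_sub, reassoc_of% hr]; simp)
  refine ⟨s, ?_⟩
  rw [← cancel_epi d, reassoc_of% hs, Preadditive.sub_comp, Category.assoc, h.zero]
  simp

end IsWeakShortExact

end Splitting

/-! ### Short exact sequences and vanishing of `Ext¹` -/

namespace ExactStructure

variable {B : Type u} [Category.{v} B] [Preadditive B] [HasFiniteBiproducts B]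
  {E : ExactStructure B}

/-- Two cokernels of `i` differ by an isomorphism, and exact structures are closed under
isomorphism. -/
lemma ses_of_isWeakShortExact_right {X Y Z Z' : B} {i : X ⟶ Y} {d : Y ⟶ Z} {d' : Y ⟶ Z'}
    (h : E.ses i d) (h' : IsWeakShortExact i d') : E.ses i d' := by
  have w := E.weak h
  obtain ⟨a, ha⟩ := w.exists_desc d' h'.zero
  obtain ⟨b, hb⟩ := h'.exists_desc d w.zero
  have := w.epi
  have := h'.epi
  refine E.ses_of_iso (Iso.refl X) (Iso.refl Y)
    ⟨a, b, by rw [← cancel_epi d, reassoc_of% ha, hb, Category.comp_id],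
      by rw [← cancel_epi d', reassoc_of% hb, ha, Category.comp_id]⟩ ?_ ?_ h
  · simp
  · simpa using ha

lemma ses_of_isWeakShortExact_left {X X' Y Z : B} {i : X ⟶ Y} {i' : X' ⟶ Y} {d : Y ⟶ Z}
    (h : E.ses i d) (h' : IsWeakShortExact i' d) : E.ses i' d := by
  have w := E.weak h
  obtain ⟨a, ha⟩ := h'.exists_lift i w.zero
  obtain ⟨b, hb⟩ := w.exists_lift i' h'.zero
  have := w.mono
  have := h'.mono
  refine E.ses_of_iso
    ⟨a, b, by rw [← cancel_mono i, Category.assoc, hb, ha, Category.id_comp],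
      by rw [← cancel_mono i', Category.assoc, ha, hb, Category.id_comp]⟩
    (Iso.refl Y) (Iso.refl Z) ?_ ?_ h
  · simpa using ha.symm
  · simp

/-- The pushout of a short exact sequence along a morphism from its first term. -/
lemma exists_pushout_ses {X Y Z X' : B} {i : X ⟶ Y} {d : Y ⟶ Z} (g : X ⟶ X') (h : E.ses i d) :
    ∃ (Y' : B) (g' : Y ⟶ Y') (i' : X' ⟶ Y') (d' : Y' ⟶ Z),
      IsPushout i g g' i' ∧ g' ≫ d' = d ∧ E.ses i' d' := by
  obtain ⟨Y', g', i', sq, Z', e, he⟩ := E.exists_pushout g h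
  have w := E.weak h
  have w' := E.weak he
  have := w.epi
  have := w'.mono
  let d' : Y' ⟶ Z := sq.desc d 0 (by rw [w.zero, comp_zero])
  have h1 : g' ≫ d' = d := sq.inl_desc _ _ _
  have h2 : i' ≫ d' = 0 := sq.inr_desc _ _ _
  have : Epi d' := epi_of_epi_fac h1
  refine ⟨Y', g', i', d', sq, h1, ses_of_isWeakShortExact_right he ?_⟩
  have key : ∀ (T : B) (f : Y' ⟶ T), i' ≫ f = 0 → ∃ l : Z ⟶ T, d' ≫ l = f := fun T f hf => by
    obtain ⟨l, hl⟩ := w.exists_desc (g' ≫ f) (by rw [reassoc_of% sq.w, hf, comp_zero])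
    exact ⟨l, sq.hom_ext (by rw [reassoc_of% h1, hl]) (by rw [reassoc_of% h2, zero_comp, hf])⟩
  refine IsWeakShortExact.of_exists_lift_desc h2 (fun T f hf => ?_) key
  -- `e` factors through `d'`, so whatever `d'` kills is killed by `e` and lifts through its kernel
  -- `i'`.
  obtain ⟨l, hl⟩ := key _ e w'.zero
  exact w'.exists_lift f (by rw [← hl, reassoc_of% hf, zero_comp])

/-- The pullback of a short exact sequence along a morphism to its last term. -/
lemma exists_pullback_ses {X Y Z Z' : B} {i : X ⟶ Y} {d : Y ⟶ Z} (f : Z' ⟶ Z) (h : E.ses i d) :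
    ∃ (Y' : B) (f' : Y' ⟶ Y) (d' : Y' ⟶ Z') (i' : X ⟶ Y'),
      IsPullback f' d' d f ∧ i' ≫ f' = i ∧ E.ses i' d' := by
  obtain ⟨Y', f', d', sq, X', e, he⟩ := E.exists_pullback f h
  have w := E.weak h
  have w' := E.weak he
  have := w.mono
  have := w'.epi
  let i' : X ⟶ Y' := sq.lift i 0 (by rw [w.zero, zero_comp])
  have h1 : i' ≫ f' = i := sq.lift_fst _ _ _
  have h2 : i' ≫ d' = 0 := sq.lift_snd _ _ _
  have : Mono i' := mono_of_mono_fac h1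
  refine ⟨Y', f', d', i', sq, h1, ses_of_isWeakShortExact_left he ?_⟩
  have key : ∀ (T : B) (g : T ⟶ Y'), g ≫ d' = 0 → ∃ l : T ⟶ X, l ≫ i' = g := fun T g hg => by
    obtain ⟨l, hl⟩ := w.exists_lift (g ≫ f') (by rw [Category.assoc, sq.w, reassoc_of% hg, zero_comp])
    exact ⟨l, sq.hom_ext (by rw [Category.assoc, h1, hl])
      (by rw [Category.assoc, h2, comp_zero, hg])⟩
  refine IsWeakShortExact.of_exists_lift_desc h2 key (fun T g hg => ?_)
  obtain ⟨l, hl⟩ := key _ e w'.zero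
  exact w'.exists_desc g (by rw [← hl, Category.assoc, hg, comp_zero])

namespace Ext1Vanishes

variable {𝒰 𝒱 : ObjectProperty B}

/-- The pushout of the sequence along `f` splits; composing with a retraction extends `f`. -/
lemma exists_extension (hE : E.Ext1Vanishes 𝒰 𝒱) {X Y U V : B} {i : X ⟶ Y} {d : Y ⟶ U}
    (h : E.ses i d) (hU : 𝒰 U) (hV : 𝒱 V) (f : X ⟶ V) : ∃ g : Y ⟶ V, i ≫ g = f := by
  obtain ⟨Y', g', i', d', sq, -, h'⟩ := exists_pushout_ses f h
  obtain ⟨s, hs⟩ := hE i' d' hV hU h'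
  obtain ⟨r, hr⟩ := (E.weak h').exists_retraction s hs
  exact ⟨g' ≫ r, by rw [reassoc_of% sq.w, hr, Category.comp_id]⟩

lemma exists_lift (hE : E.Ext1Vanishes 𝒰 𝒱) {Y Z U V : B} {i : V ⟶ Y} {d : Y ⟶ Z}
    (h : E.ses i d) (hU : 𝒰 U) (hV : 𝒱 V) (f : U ⟶ Z) : ∃ g : U ⟶ Y, g ≫ d = f := by
  obtain ⟨Y', f', d', i', sq, -, h'⟩ := exists_pullback_ses f h
  obtain ⟨s, hs⟩ := hE i' d' hV hU h'
  exact ⟨s ≫ f', by rw [Category.assoc, sq.w, reassoc_of% hs]⟩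

end Ext1Vanishes

namespace IsCotorsionPair

variable {𝒰 𝒱 : ObjectProperty B}

/-- Splitting the approximation `V ↣ V' ↠ U` makes `V` a summand of `V'`; thus `𝒱` is the full
Ext-orthogonal of `𝒰`. -/
lemma right_of_splits (h : E.IsCotorsionPair 𝒰 𝒱) {V : B}
    (hV : ∀ ⦃Y U : B⦄ (i : V ⟶ Y) (d : Y ⟶ U), 𝒰 U → E.ses i d → ∃ r : Y ⟶ V, i ≫ r = 𝟙 V) :
    𝒱 V := by
  obtain ⟨V', U, i, d, hV', hU, hs⟩ := h.right_approx V
  obtain ⟨r, hr⟩ := hV i d hU hs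
  exact h.right_summands.of_retract ⟨i, r, hr⟩ hV'

lemma left_of_splits (h : E.IsCotorsionPair 𝒰 𝒱) {U : B}
    (hU : ∀ ⦃V Y : B⦄ (i : V ⟶ Y) (d : Y ⟶ U), 𝒱 V → E.ses i d → ∃ s : U ⟶ Y, s ≫ d = 𝟙 U) :
    𝒰 U := by
  obtain ⟨V, U', i, d, hV, hU', hs⟩ := h.left_approx U
  obtain ⟨s, hs'⟩ := hU i d hV hs
  exact h.left_summands.of_retract ⟨s, d, hs'⟩ hU'

lemma right_biprod (h : E.IsCotorsionPair 𝒰 𝒱) {V V' : B} (hV : 𝒱 V) (hV' : 𝒱 V') :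
    𝒱 (V ⊞ V') := by
  refine h.right_of_splits fun Y U i d hU hs => ?_
  obtain ⟨g, hg⟩ := h.ext.exists_extension hs hU hV biprod.fst
  obtain ⟨g', hg'⟩ := h.ext.exists_extension hs hU hV' biprod.snd
  exact ⟨biprod.lift g g', by ext <;> simp [hg, hg']⟩

lemma proj_le_left (h : E.IsCotorsionPair 𝒰 𝒱) {P : B} (hP : E.proj P) : 𝒰 P :=
  h.left_of_splits fun _ _ _ d _ hs => hP d ⟨_, _, hs⟩ (𝟙 P)

lemma left_le_right (h : E.IsCotorsionPair 𝒰 𝒱) (hr : E.IsRigid 𝒰) {U : B} (hU : 𝒰 U) : 𝒱 U :=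
  h.right_of_splits fun _ _ _ _ hU' hs => hr.exists_extension hs hU' hU (𝟙 U)

lemma mem_factorIdeal_right (h : E.IsCotorsionPair 𝒰 𝒱) {X Y : B} (f : X ⟶ Y) :
    f ∈ factorIdeal 𝒱 X Y ↔ f ∈ factorSet 𝒱 X Y := by
  refine mem_factorIdeal 𝒱 ?_ (fun _ _ => h.right_biprod) f
  obtain ⟨V, -, -, -, hV, -⟩ := h.left_approx X
  exact ⟨V, hV⟩

end IsCotorsionPair

/-! ### Morphisms between syzygies -/

lemma exists_projPres (hP : E.EnoughProjectives) (X : B) : Nonempty (E.ProjPres X) := by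
  obtain ⟨P, d, hP, K, i, h⟩ := hP X
  exact ⟨⟨K, P, i, d, hP, h⟩⟩

namespace ProjPres

variable {X Y Z : B} {p : E.ProjPres X} {q : E.ProjPres Y} {r : E.ProjPres Z}

lemma weak (p : E.ProjPres X) : IsWeakShortExact p.ι p.π := E.weak p.ses

lemma Represents.comp {f : X ⟶ Y} {g : Y ⟶ Z} {a : p.syz ⟶ q.syz} {b : q.syz ⟶ r.syz}
    (ha : p.Represents q f a) (hb : q.Represents r g b) : p.Represents r (f ≫ g) (a ≫ b) := by
  obtain ⟨s, h1, h2⟩ := ha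
  obtain ⟨t, h3, h4⟩ := hb
  exact ⟨s ≫ t, by rw [Category.assoc, h3, reassoc_of% h1],
    by rw [Category.assoc, h4, reassoc_of% h2]⟩

lemma Represents.sub {f g : X ⟶ Y} {a b : p.syz ⟶ q.syz}
    (ha : p.Represents q f a) (hb : p.Represents q g b) : p.Represents q (f - g) (a - b) := by
  obtain ⟨s, h1, h2⟩ := ha
  obtain ⟨t, h3, h4⟩ := hb
  exact ⟨s - t, by simp [Preadditive.sub_comp, Preadditive.comp_sub, h1, h3],
    by simp [Preadditive.sub_comp, Preadditive.comp_sub, h2, h4]⟩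

/-- A morphism that factors through a projective is represented by zero. -/
lemma represents_zero {P : B} (hP : E.proj P) (f : X ⟶ P) (g : P ⟶ Y) :
    p.Represents q (f ≫ g) 0 := by
  obtain ⟨b, hb⟩ := hP q.π ⟨_, _, q.ses⟩ g
  exact ⟨p.π ≫ f ≫ b, by simp [reassoc_of% p.weak.zero], by simp [hb]⟩

/-- A morphism represented by one that factors through the projective cover itself factors
through a projective. -/
lemma Represents.exists_factor {f : X ⟶ Y} {a : p.syz ⟶ q.syz} (h : p.Represents q f a)
    (t : p.P ⟶ q.syz) (ht : a = p.ι ≫ t) : ∃ s : X ⟶ q.P, s ≫ q.π = f := by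
  obtain ⟨b, h1, h2⟩ := h
  -- Correcting the lift `b` by `t` makes it vanish on `ΩX`, without changing its composite to `Y`.
  obtain ⟨s, hs⟩ := p.weak.exists_desc (b - t ≫ q.ι)
    (by rw [Preadditive.comp_sub, ← h1, ht, Category.assoc, sub_self])
  have := p.weak.epi
  refine ⟨s, ?_⟩
  rw [← cancel_epi p.π, reassoc_of% hs, Preadditive.sub_comp, h2, Category.assoc, q.weak.zero]
  simp

end ProjPres

namespace IsCotorsionPair

variable {𝒞 𝒦 : ObjectProperty B}

/-- Ext¹(C, Z) = 0 for `Z` in `𝒦`, so the first factor `ΩC ⟶ Z` already extends over the projective.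
-/
lemma exists_factor_of_mem_factorSet (h : E.IsCotorsionPair 𝒞 𝒦) {C T : B} (hC : 𝒞 C)
    (p : E.ProjPres C) {f : p.syz ⟶ T} (hf : f ∈ factorSet 𝒦 p.syz T) :
    ∃ s : p.P ⟶ T, f = p.ι ≫ s := by
  obtain ⟨Z, a, b, hZ, rfl⟩ := hf
  obtain ⟨g, hg⟩ := h.ext.exists_extension p.ses hC hZ a
  exact ⟨g ≫ b, by rw [reassoc_of% hg]⟩

/-- `Ω` is full on `𝒞`: projectives lie in `𝒞`, so by rigidity a map from `ΩC` to a projective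
extends over `P`. -/
lemma exists_represented (h : E.IsCotorsionPair 𝒞 𝒦) (hr : E.IsRigid 𝒞) {C C' : B} (hC : 𝒞 C)
    (p : E.ProjPres C) (q : E.ProjPres C') (t : p.syz ⟶ q.syz) :
    ∃ c : C ⟶ C', p.Represents q c t := by
  obtain ⟨b, hb⟩ := hr.exists_extension p.ses hC (h.proj_le_left q.projective) (t ≫ q.ι)
  obtain ⟨c, hc⟩ := p.weak.exists_desc (b ≫ q.π)
    (by rw [reassoc_of% hb, q.weak.zero, comp_zero])
  exact ⟨c, b, hb.symm, hc.symm⟩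

end IsCotorsionPair

end ExactStructure

/-! ### Quotient functors -/

/-- `Q` is, up to the names of objects, the quotient functor by the ideal of the morphisms that
factor through an object of `W`. -/
structure IsQuotientFunctor {B : Type u} [Category.{v} B] [Preadditive B] (W : ObjectProperty B)
    {A : Type u} [Category.{v} A] [Preadditive A] (Q : B ⥤ A) : Prop where
  obj_surjective : Function.Surjective Q.obj
  full : Q.Full
  additive : Q.Additive
  map_eq_zero_iff : ∀ {X Y : B} (f : X ⟶ Y), Q.map f = 0 ↔ f ∈ factorSet W X Y

namespace IsQuotientFunctor

variable {B : Type u} [Category.{v} B] [Preadditive B] {W : ObjectProperty B}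
  {A : Type u} [Category.{v} A] [Preadditive A] {Q : B ⥤ A} (hQ : IsQuotientFunctor W Q)

include hQ

lemma exists_map_eq {X Y : B} (f : Q.obj X ⟶ Q.obj Y) : ∃ g : X ⟶ Y, Q.map g = f := by
  have := hQ.full
  exact Q.map_surjective f

lemma map_eq_zero {X Y Z : B} (hZ : W Z) (a : X ⟶ Z) (b : Z ⟶ Y) : Q.map (a ≫ b) = 0 :=
  (hQ.map_eq_zero_iff _).2 ⟨Z, a, b, hZ, rfl⟩

lemma map_eq_of_sub {X Y : B} {f g : X ⟶ Y} (h : f - g ∈ factorSet W X Y) :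
    Q.map f = Q.map g := by
  have := hQ.additive
  rwa [← sub_eq_zero, ← Q.map_sub, hQ.map_eq_zero_iff]

lemma obj_eq_zero {X : B} (hX : W X) {T : A} (f : Q.obj X ⟶ T) : f = 0 := by
  have := hQ.map_eq_zero hX (𝟙 X) (𝟙 X)
  rw [Category.comp_id, Q.map_id] at this
  rw [← Category.id_comp f, this, zero_comp]

end IsQuotientFunctor

/-! ### The exact sequence of syzygies attached to a coresolution -/

namespace ExactStructure

variable {B : Type u} [Category.{v} B] [Preadditive B] [HasFiniteBiproducts B]
  {E : ExactStructure B}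

/-- `δ : ΩZ ⟶ X` is a connecting morphism of the short exact sequence `(x, d)`. -/
def ProjPres.IsConnecting {X Y Z : B} (q : E.ProjPres Z) (x : X ⟶ Y) (d : Y ⟶ Z)
    (δ : q.syz ⟶ X) : Prop :=
  ∃ b : q.P ⟶ Y, b ≫ d = q.π ∧ δ ≫ x = q.ι ≫ b

lemma ProjPres.exists_isConnecting {X Y Z : B} (q : E.ProjPres Z) {x : X ⟶ Y} {d : Y ⟶ Z}
    (h : E.ses x d) : ∃ δ, q.IsConnecting x d δ := by
  obtain ⟨b, hb⟩ := q.projective d ⟨_, _, h⟩ q.π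
  obtain ⟨δ, hδ⟩ := (E.weak h).exists_lift (q.ι ≫ b) (by rw [Category.assoc, hb, q.weak.zero])
  exact ⟨δ, b, hb, hδ⟩

section Coresolution

variable {𝒞 𝒦 : ObjectProperty B} {A : Type u} [Category.{v} A] [Preadditive A] {Q : B ⥤ A}
  {X C₁ C₂ : B} {x : X ⟶ C₁} {d : C₁ ⟶ C₂} {q₁ : E.ProjPres C₁} {q₂ : E.ProjPres C₂}
  {i : q₁.syz ⟶ q₂.syz} {δ : q₂.syz ⟶ X}

lemma map_comp_connecting (hCK : E.IsCotorsionPair 𝒞 𝒦) (hr : E.IsRigid 𝒞)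
    (hQ : IsQuotientFunctor 𝒦 Q) (h : E.ses x d) (hi : q₁.Represents q₂ d i)
    (hδ : q₂.IsConnecting x d δ) : Q.map i ≫ Q.map δ = 0 := by
  obtain ⟨b, hb, hbx⟩ := hδ
  obtain ⟨n, hn, hn'⟩ := hi
  have w := E.weak h
  have := w.mono
  -- Both maps `P₁ ⟶ C₁` have the same composite to `C₂`, so they differ by a map into `X`; it
  -- exhibits `i ≫ δ` as factoring through `P₁`.
  obtain ⟨k, hk⟩ := w.exists_lift (n ≫ b - q₁.π)
    (by rw [Preadditive.sub_comp, Category.assoc, hb, hn', sub_self])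
  have : i ≫ δ = q₁.ι ≫ k := by
    rw [← cancel_mono x, Category.assoc, Category.assoc, hk, hbx, reassoc_of% hn,
      Preadditive.comp_sub, q₁.weak.zero, sub_zero]
  rw [← Q.map_comp, this]
  exact hQ.map_eq_zero (hCK.left_le_right hr (hCK.proj_le_left q₁.projective)) _ _

/-- If `δ ≫ f` dies, the pushout of `(x, d)` along `f` has zero class in Ext¹(C₂, T), so `f` extends
along `x` to `C₁`, an object of `𝒦`. The extension is built inside `T ↣ V ↠ U`, where `f ≫ t`
extends for free and is then corrected by a map from `C₂`. -/
lemma epi_map_connecting (hCK : E.IsCotorsionPair 𝒞 𝒦) (hr : E.IsRigid 𝒞)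
    (hQ : IsQuotientFunctor 𝒦 Q) (h : E.ses x d) (hC₁ : 𝒞 C₁) (hC₂ : 𝒞 C₂)
    (hδ : q₂.IsConnecting x d δ) : Epi (Q.map δ) := by
  obtain ⟨b, hb, hbx⟩ := hδ
  refine Preadditive.epi_of_cancel_zero _ fun {T} f hf => ?_
  obtain ⟨T, rfl⟩ := hQ.obj_surjective T
  obtain ⟨f, rfl⟩ := hQ.exists_map_eq f
  rw [← Q.map_comp, hQ.map_eq_zero_iff] at hf
  obtain ⟨s, hs⟩ := hCK.exists_factor_of_mem_factorSet hC₂ q₂ hf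
  obtain ⟨V, U, t, e, hV, hU, hT⟩ := hCK.right_approx T
  have w := E.weak h
  have wT := E.weak hT
  have := wT.mono
  have := w.epi
  have := q₂.weak.epi
  obtain ⟨n, hn⟩ := hCK.ext.exists_extension h hC₂ hV (f ≫ t)
  obtain ⟨c, hc⟩ := w.exists_desc (n ≫ e) (by rw [reassoc_of% hn, wT.zero, comp_zero])
  obtain ⟨k, hk⟩ := q₂.weak.exists_desc (b ≫ n - s ≫ t)
    (by rw [Preadditive.comp_sub, ← reassoc_of% hbx, hn, reassoc_of% hs, sub_self])
  have hke : k ≫ e = c := by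
    rw [← cancel_epi q₂.π, reassoc_of% hk, Preadditive.sub_comp, Category.assoc, Category.assoc,
      wT.zero, comp_zero, sub_zero, ← hc, reassoc_of% hb]
  obtain ⟨r, hr'⟩ := wT.exists_lift (n - d ≫ k)
    (by rw [Preadditive.sub_comp, Category.assoc, hke, hc, sub_self])
  have : f = x ≫ r := by
    rw [← cancel_mono t, Category.assoc, hr', Preadditive.comp_sub, hn, reassoc_of% w.zero,
      zero_comp, sub_zero]
  rw [this]
  exact hQ.map_eq_zero (hCK.left_le_right hr hC₁) _ _

/-- This is exactness of Hom(X, T) ⟶ Ext¹(C₂, T) ⟶ Ext¹(C₁, T). The class of `f` is given by `c : C₂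
⟶ U`; that its pullback to `C₁` is zero means that `d ≫ c` lifts to `k : C₁ ⟶ V`, and `x ≫ k` lands
in `T`. -/
lemma exists_desc_map_connecting (hCK : E.IsCotorsionPair 𝒞 𝒦) (hr : E.IsRigid 𝒞)
    (hQ : IsQuotientFunctor 𝒦 Q) (h : E.ses x d) (hC₁ : 𝒞 C₁) (hC₂ : 𝒞 C₂)
    (hi : q₁.Represents q₂ d i) (hδ : q₂.IsConnecting x d δ) {T : A} (f : Q.obj q₂.syz ⟶ T)
    (hf : Q.map i ≫ f = 0) : ∃ l, Q.map δ ≫ l = f := by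
  obtain ⟨b, hb, hbx⟩ := hδ
  obtain ⟨n, hn, hn'⟩ := hi
  obtain ⟨T, rfl⟩ := hQ.obj_surjective T
  obtain ⟨f, rfl⟩ := hQ.exists_map_eq f
  rw [← Q.map_comp, hQ.map_eq_zero_iff] at hf
  obtain ⟨s, hs⟩ := hCK.exists_factor_of_mem_factorSet hC₁ q₁ hf
  obtain ⟨V, U, t, v, hV, hU, hT⟩ := hCK.right_approx T
  have w := E.weak h
  have wT := E.weak hT
  have := wT.mono
  have := q₁.weak.epi
  obtain ⟨e, he⟩ := hCK.ext.exists_extension q₂.ses hC₂ hV (f ≫ t)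
  obtain ⟨c, hc⟩ := q₂.weak.exists_desc (e ≫ v) (by rw [reassoc_of% he, wT.zero, comp_zero])
  obtain ⟨k, hk⟩ := q₁.weak.exists_desc (n ≫ e - s ≫ t)
    (by rw [Preadditive.comp_sub, ← reassoc_of% hn, he, reassoc_of% hs, sub_self])
  have hkv : k ≫ v = d ≫ c := by
    rw [← cancel_epi q₁.π, reassoc_of% hk, Preadditive.sub_comp, Category.assoc, Category.assoc,
      wT.zero, comp_zero, sub_zero, ← hc, reassoc_of% hn']
  obtain ⟨r, hrt⟩ := wT.exists_lift (x ≫ k)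
    (by rw [Category.assoc, hkv, reassoc_of% w.zero, zero_comp])
  obtain ⟨y, hy⟩ := wT.exists_lift (b ≫ k - e)
    (by rw [Preadditive.sub_comp, Category.assoc, hkv, reassoc_of% hb, hc, sub_self])
  refine ⟨Q.map r, ?_⟩
  rw [← Q.map_comp]
  refine hQ.map_eq_of_sub ⟨q₂.P, q₂.ι, y, hCK.left_le_right hr (hCK.proj_le_left q₂.projective), ?_⟩
  rw [← cancel_mono t, Category.assoc, hy, Preadditive.comp_sub, Preadditive.sub_comp, he,
    Category.assoc, hrt, reassoc_of% hbx]

/-- Exactness at `ΩC₂`, tested on syzygies. -/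
lemma exists_lift_map_of_comp_connecting (hCK : E.IsCotorsionPair 𝒞 𝒦) (hr : E.IsRigid 𝒞)
    (hQ : IsQuotientFunctor 𝒦 Q) (h : E.ses x d)
    (hi : q₁.Represents q₂ d i) (hδ : q₂.IsConnecting x d δ) {C : B} (hC : 𝒞 C)
    (p : E.ProjPres C) (t : Q.obj p.syz ⟶ Q.obj q₂.syz) (ht : t ≫ Q.map δ = 0) :
    ∃ l, l ≫ Q.map i = t := by
  obtain ⟨b, hb, hbx⟩ := hδ
  obtain ⟨t, rfl⟩ := hQ.exists_map_eq t
  rw [← Q.map_comp, hQ.map_eq_zero_iff] at ht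
  obtain ⟨s, hs⟩ := hCK.exists_factor_of_mem_factorSet hC p ht
  obtain ⟨c, hc⟩ := hCK.exists_represented hr hC p q₂ t
  have hc' := hc
  obtain ⟨m, hm, hm'⟩ := hc'
  have := p.weak.epi
  have w := E.weak h
  -- With `t = Ωc`, the vanishing of `t ≫ δ` lets `c` lift through `d` to `k : C ⟶ C₁`; then `Ωk` is
  -- the required lift of `t`.
  obtain ⟨k, hk⟩ := p.weak.exists_desc (m ≫ b - s ≫ x)
    (by rw [Preadditive.comp_sub, ← reassoc_of% hm, ← hbx, reassoc_of% hs, sub_self])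
  have hkd : k ≫ d = c := by
    rw [← cancel_epi p.π, reassoc_of% hk, Preadditive.sub_comp, Category.assoc, Category.assoc,
      w.zero, comp_zero, sub_zero, hb, hm']
  obtain ⟨l, hl⟩ := p.exists_represents q₁ k
  refine ⟨Q.map l, ?_⟩
  rw [← Q.map_comp]
  obtain ⟨y, hy⟩ := (hkd ▸ hl.comp hi).sub_factors hc
  exact hQ.map_eq_of_sub ⟨p.P, p.ι, y, hCK.left_le_right hr (hCK.proj_le_left p.projective), hy.symm⟩

/-- Exactness at `ΩC₁`, tested on syzygies. -/
lemma exists_represents_comp (hCK : E.IsCotorsionPair 𝒞 𝒦) (hr : E.IsRigid 𝒞)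
    (hQ : IsQuotientFunctor 𝒦 Q) (h : E.ses x d) (hi : q₁.Represents q₂ d i) {C : B} (hC : 𝒞 C)
    (p : E.ProjPres C) (t : p.syz ⟶ q₁.syz) (ht : Q.map t ≫ Q.map i = 0) :
    ∃ g : C ⟶ X, p.Represents q₁ (g ≫ x) t := by
  rw [← Q.map_comp, hQ.map_eq_zero_iff] at ht
  obtain ⟨s, hs⟩ := hCK.exists_factor_of_mem_factorSet hC p ht
  obtain ⟨c, hc⟩ := hCK.exists_represented hr hC p q₁ t
  obtain ⟨a, ha⟩ := (hc.comp hi).exists_factor s hs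
  obtain ⟨b, hb⟩ := q₂.projective d ⟨_, _, h⟩ q₂.π
  -- `c ≫ d` factors through `P₂`, hence lifts to `C₁` as `a ≫ b`. Subtracting this lift moves `c`
  -- into `X` and does not change `Ωc`.
  obtain ⟨g, hg⟩ := (E.weak h).exists_lift (c - a ≫ b)
    (by rw [Preadditive.sub_comp, Category.assoc, hb, ha, sub_self])
  refine ⟨g, hg ▸ ?_⟩
  simpa using hc.sub (ProjPres.represents_zero (p := p) (q := q₁) q₂.projective a b)

/-- By `exists_represents_comp`, `t` is `Ω(g ≫ x)`, which factors through the vanishing `Ωx`. -/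
lemma eq_zero_of_comp_map_eq_zero (hCK : E.IsCotorsionPair 𝒞 𝒦) (hr : E.IsRigid 𝒞)
    (hQ : IsQuotientFunctor 𝒦 Q) (h : E.ses x d) (hi : q₁.Represents q₂ d i)
    {p₀ : E.ProjPres X} {a : p₀.syz ⟶ q₁.syz} (ha : p₀.Represents q₁ x a) (h0 : Q.map a = 0)
    {C : B} (hC : 𝒞 C) (p : E.ProjPres C) (t : Q.obj p.syz ⟶ Q.obj q₁.syz)
    (ht : t ≫ Q.map i = 0) : t = 0 := by
  obtain ⟨t, rfl⟩ := hQ.exists_map_eq t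
  obtain ⟨g, hg⟩ := exists_represents_comp hCK hr hQ h hi hC p t ht
  obtain ⟨g', hg'⟩ := p.exists_represents p₀ g
  obtain ⟨y, hy⟩ := hg.sub_factors (hg'.comp ha)
  rw [hQ.map_eq_of_sub ⟨p.P, p.ι, y, hCK.left_le_right hr (hCK.proj_le_left p.projective), hy.symm⟩,
    Q.map_comp, h0, comp_zero]

end Coresolution

/-- The syzygies of objects of `𝒞` become projective in the quotient by `𝒦`. -/
lemma projective_map_syz {𝒞 𝒦 : ObjectProperty B} {A : Type u} [Category.{v} A] [Preadditive A]
    {Q : B ⥤ A} (hCK : E.IsCotorsionPair 𝒞 𝒦) (hr : E.IsRigid 𝒞) (hQ : IsQuotientFunctor 𝒦 Q)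
    {C : B} (hC : 𝒞 C) (p : E.ProjPres C) : Projective (Q.obj p.syz) := by
  refine ⟨fun {Y Z} h f _ => ?_⟩
  obtain ⟨Y, rfl⟩ := hQ.obj_surjective Y
  obtain ⟨Z, rfl⟩ := hQ.obj_surjective Z
  obtain ⟨f, rfl⟩ := hQ.exists_map_eq f
  obtain ⟨h, rfl⟩ := hQ.exists_map_eq h
  obtain ⟨V, U, t, v, hV, hU, hY⟩ := hCK.right_approx Y
  obtain ⟨W, g', w, v', sq, hv, hW⟩ := exists_pushout_ses f hY
  have wY := E.weak hY
  have wW := E.weak hW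
  have := wW.mono
  -- `f ≫ w` factors through `V` in `𝒦`, and `f` is epi in the quotient. So `h ≫ w` dies, and
  -- therefore extends over `P`.
  have hw : Q.map w = 0 := by
    rw [← cancel_epi (Q.map f), ← Q.map_comp, ← sq.w, comp_zero]
    exact hQ.map_eq_zero hV _ _
  have hhw : Q.map (h ≫ w) = 0 := by rw [Q.map_comp, hw, comp_zero]
  rw [hQ.map_eq_zero_iff] at hhw
  obtain ⟨m, hm⟩ := hCK.exists_factor_of_mem_factorSet hC p hhw
  obtain ⟨q, hq⟩ := p.projective v ⟨_, _, hY⟩ (m ≫ v')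
  obtain ⟨s, hs⟩ := wW.exists_lift (m - q ≫ g')
    (by rw [Preadditive.sub_comp, Category.assoc, hv, hq, sub_self])
  have key : (h - p.ι ≫ s) ≫ w = p.ι ≫ q ≫ g' := by
    rw [Preadditive.sub_comp, hm, Category.assoc, hs, Preadditive.comp_sub, sub_sub_cancel]
  obtain ⟨k, hk⟩ := wY.exists_lift (p.ι ≫ q)
    (by rw [← hv, Category.assoc, ← reassoc_of% key, wW.zero, comp_zero])
  have hkf : k ≫ f = h - p.ι ≫ s := by
    rw [← cancel_mono w, key, Category.assoc, ← sq.w, reassoc_of% hk]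
  refine ⟨Q.map k, ?_⟩
  rw [← Q.map_comp]
  exact (hQ.map_eq_of_sub ⟨p.P, p.ι, s, hCK.left_le_right hr (hCK.proj_le_left p.projective),
    by rw [hkf, sub_sub_cancel]⟩).symm

end ExactStructure

/-! ### Local decompositions and the radical -/

section LocalDecomposition

variable {B : Type u} [Category.{v} B] [Preadditive B]

/-- `F` has a local endomorphism ring. -/
def HasLocalEnd (F : B) : Prop :=
  𝟙 F ≠ 0 ∧ ∀ f : F ⟶ F, IsIso f ∨ IsIso (𝟙 F - f)

variable (B) in
/-- Every object is a finite direct sum of objects with local endomorphism rings. -/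
def HasLocalDecompositions : Prop :=
  ∀ X : B, ∃ (n : ℕ) (F : Fin n → B) (ι : ∀ j, F j ⟶ X) (π : ∀ j, X ⟶ F j),
    (∀ j, HasLocalEnd (F j)) ∧ (∀ j, ι j ≫ π j = 𝟙 (F j)) ∧ ∑ j, π j ≫ ι j = 𝟙 X

lemma HasLocalEnd.of_isLocalRing {F : B} (h : IsLocalRing (End F)) : HasLocalEnd F := by
  refine ⟨fun h0 => one_ne_zero (α := End F) h0, fun f => ?_⟩
  have := IsLocalRing.isUnit_or_isUnit_of_add_one (R := End F) (a := f) (b := 𝟙 F - f)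
    (add_sub_cancel (f : F ⟶ F) (𝟙 F))
  rwa [isUnit_iff_isIso, isUnit_iff_isIso] at this

lemma IsKrullSchmidt.hasLocalDecompositions [HasFiniteBiproducts B] (h : IsKrullSchmidt B) :
    HasLocalDecompositions B := by
  intro X
  obtain ⟨n, F, hF, ⟨e⟩⟩ := h X
  refine ⟨n, F, fun j => biproduct.ι F j ≫ e.inv, fun j => e.hom ≫ biproduct.π F j,
    fun j => .of_isLocalRing (hF j), fun j => by simp, ?_⟩
  have : ∑ j, (e.hom ≫ biproduct.π F j) ≫ biproduct.ι F j ≫ e.inv =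
      e.hom ≫ (∑ j, biproduct.π F j ≫ biproduct.ι F j) ≫ e.inv := by
    rw [Preadditive.sum_comp, Preadditive.comp_sum]
    exact Finset.sum_congr rfl fun j _ => by simp only [Category.assoc]
  rw [this, biproduct.total]
  simp

/-- The idempotent onto `Y` or its complement is invertible, and an invertible idempotent
annihilates the other summand. -/
lemma HasLocalEnd.indecomposable [HasBinaryBiproducts B] {F : B} (h : HasLocalEnd F) :
    Indecomposable F := by
  refine ⟨fun h0 => h.1 (h0.eq_of_src _ _), fun Y Z e => ?_⟩
  have h1 : e.inv ≫ (e.hom ≫ biprod.fst ≫ biprod.inl ≫ e.inv) ≫ e.hom = biprod.fst ≫ biprod.inl := by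
    simp
  rcases h.2 (e.hom ≫ biprod.fst ≫ biprod.inl ≫ e.inv) with hf | hf
  · right
    rw [IsZero.iff_id_eq_zero, ← cancel_mono (biprod.inr : Z ⟶ Y ⊞ Z), ← cancel_mono e.inv,
      ← cancel_mono (e.hom ≫ biprod.fst ≫ biprod.inl ≫ e.inv)]
    simp
  · left
    rw [IsZero.iff_id_eq_zero, ← cancel_mono (biprod.inl : Y ⟶ Y ⊞ Z), ← cancel_mono e.inv,
      ← cancel_mono (𝟙 F - e.hom ≫ biprod.fst ≫ biprod.inl ≫ e.inv)]
    simp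

lemma HasLocalEnd.isZero_or_isIso_of_retract {F Z : B} (h : HasLocalEnd F) (r : Retract Z F) :
    IsZero Z ∨ IsIso r.i := by
  rcases h.2 (r.r ≫ r.i) with hf | hf
  · right
    have : Epi r.i := epi_of_epi r.r r.i
    exact isIso_of_epi_of_isSplitMono r.i
  · left
    rw [IsZero.iff_id_eq_zero, ← cancel_mono r.i, ← cancel_mono (𝟙 F - r.r ≫ r.i)]
    simp

/-- The inverse `1 + g (1 - fg)⁻¹ f` is suggested by the geometric series. -/
lemma isIso_one_sub_comp_comm {X Y : B} (f : X ⟶ Y) (g : Y ⟶ X) (h : IsIso (𝟙 X - f ≫ g)) :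
    IsIso (𝟙 Y - g ≫ f) := by
  have h1 : inv (𝟙 X - f ≫ g) - inv (𝟙 X - f ≫ g) ≫ f ≫ g = 𝟙 X := by
    simpa [Preadditive.comp_sub] using IsIso.inv_hom_id (𝟙 X - f ≫ g)
  have h2 : inv (𝟙 X - f ≫ g) - f ≫ g ≫ inv (𝟙 X - f ≫ g) = 𝟙 X := by
    have := IsIso.hom_inv_id (𝟙 X - f ≫ g)
    rwa [Preadditive.sub_comp, Category.id_comp, Category.assoc] at this
  refine ⟨𝟙 Y + g ≫ inv (𝟙 X - f ≫ g) ≫ f, ?_, ?_⟩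
  · rw [sub_eq_iff_eq_add] at h2
    have : g ≫ inv (𝟙 X - f ≫ g) ≫ f = g ≫ f + g ≫ f ≫ g ≫ inv (𝟙 X - f ≫ g) ≫ f := by
      conv_lhs => rw [h2]
      simp
    simp only [Preadditive.sub_comp, Preadditive.comp_add, Category.comp_id, Category.id_comp,
      Category.assoc]
    nth_rw 1 [this]
    abel
  · rw [sub_eq_iff_eq_add] at h1
    have : g ≫ inv (𝟙 X - f ≫ g) ≫ f = g ≫ f + g ≫ inv (𝟙 X - f ≫ g) ≫ f ≫ g ≫ f := by
      conv_lhs => rw [h1]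
      simp
    simp only [Preadditive.comp_sub, Preadditive.add_comp, Category.comp_id, Category.id_comp,
      Category.assoc]
    nth_rw 1 [this]
    abel

/-- The radical of a preadditive category. -/
def IsRadicalHom {X Y : B} (f : X ⟶ Y) : Prop := ∀ g : Y ⟶ X, IsIso (𝟙 X - f ≫ g)

namespace IsRadicalHom

lemma zero (X Y : B) : IsRadicalHom (0 : X ⟶ Y) := fun g => by
  rw [zero_comp, sub_zero]
  infer_instance

lemma comp_left {X Y Z : B} {f : Y ⟶ Z} (hf : IsRadicalHom f) (h : X ⟶ Y) : IsRadicalHom (h ≫ f) :=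
  fun g => by simpa using isIso_one_sub_comp_comm _ _ (by simpa using hf (g ≫ h))

lemma add {X Y : B} {f f' : X ⟶ Y} (hf : IsRadicalHom f) (hf' : IsRadicalHom f') :
    IsRadicalHom (f + f') := fun g => by
  have h1 := hf g
  have h2 := hf'.comp_left (inv (𝟙 X - f ≫ g)) g
  have : 𝟙 X - (f + f') ≫ g =
      (𝟙 X - f ≫ g) ≫ (𝟙 X - (inv (𝟙 X - f ≫ g) ≫ f') ≫ g) := by
    rw [Preadditive.comp_sub, Category.assoc, IsIso.hom_inv_id_assoc, Category.comp_id,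
      Preadditive.add_comp, sub_sub]
  rw [this]
  infer_instance

lemma sum {X Y : B} {J : Type*} (s : Finset J) (f : J → (X ⟶ Y)) (hf : ∀ j ∈ s, IsRadicalHom (f j)) :
    IsRadicalHom (∑ j ∈ s, f j) :=
  Finset.sum_induction f IsRadicalHom (fun _ _ => add) (zero X Y) hf

end IsRadicalHom

/-- If no nonzero retract of `X` lies in `W`, the endomorphisms of `X` that factor through `W` lie
in the radical. -/
lemma isIso_one_sub_of_mem_factorSet (hB : HasLocalDecompositions B) {W : ObjectProperty B}
    (hW : W.IsStableUnderRetracts) {X : B}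
    (hX : ∀ Z : B, Nonempty (Retract Z X) → W Z → IsZero Z) {f : X ⟶ X}
    (hf : f ∈ factorSet W X X) : IsIso (𝟙 X - f) := by
  obtain ⟨V, a, b, hV, rfl⟩ := hf
  obtain ⟨n, F, ι, π, hF, hιπ, hsum⟩ := hB X
  -- Otherwise some composite through `V` is an automorphism of `F j`, making `F j` a nonzero
  -- summand of `X` in `W`.
  have key : ∀ j, IsRadicalHom (ι j ≫ a ≫ b) := fun j g => by
    refine ((hF j).2 ((ι j ≫ a ≫ b) ≫ g)).resolve_left fun hiso => (hF j).1 ?_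
    refine IsZero.eq_of_src (hX (F j) ⟨⟨ι j, π j, hιπ j⟩⟩ ?_) _ _
    exact hW.of_retract ⟨ι j ≫ a, b ≫ g ≫ inv ((ι j ≫ a ≫ b) ≫ g), by
      simpa only [Category.assoc] using IsIso.hom_inv_id ((ι j ≫ a ≫ b) ≫ g)⟩ hV
  have hab : a ≫ b = ∑ j, π j ≫ ι j ≫ a ≫ b := by
    conv_lhs => rw [← Category.id_comp (a ≫ b), ← hsum]
    simp [Preadditive.sum_comp]
  have : IsRadicalHom (a ≫ b) := by
    rw [hab]
    exact IsRadicalHom.sum _ _ fun j _ => (key j).comp_left (π j)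
  simpa using this (𝟙 X)

/-- Lifting problems in a quotient can be solved on objects with local endomorphism rings. -/
lemma IsQuotientFunctor.exists_lift_of_local (hB : HasLocalDecompositions B)
    {W : ObjectProperty B} {A : Type u} [Category.{v} A] [Preadditive A] {Q : B ⥤ A}
    (hQ : IsQuotientFunctor W Q) {M N T : A} (m : M ⟶ N) (t : T ⟶ N)
    (h : ∀ F : B, HasLocalEnd F → ¬ W F → ∀ (s : Q.obj F ⟶ T) (r : T ⟶ Q.obj F),
      s ≫ r = 𝟙 _ → ∃ l, l ≫ m = s ≫ t) : ∃ l, l ≫ m = t := by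
  obtain ⟨T, rfl⟩ := hQ.obj_surjective T
  have := hQ.additive
  obtain ⟨n, F, ι, π, hF, hιπ, hsum⟩ := hB T
  have key : ∀ j, ∃ l, l ≫ m = Q.map (ι j) ≫ t := fun j => by
    by_cases hj : W (F j)
    · exact ⟨0, by rw [hQ.obj_eq_zero hj (_ ≫ t), zero_comp]⟩
    · exact h _ (hF j) hj (Q.map (ι j)) (Q.map (π j)) (by rw [← Q.map_comp, hιπ, Q.map_id])
  choose l hl using key
  refine ⟨∑ j, Q.map (π j) ≫ l j, ?_⟩
  calc (∑ j, Q.map (π j) ≫ l j) ≫ m = Q.map (∑ j, π j ≫ ι j) ≫ t := by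
        simp [Preadditive.sum_comp, Functor.map_sum, hl]
    _ = t := by rw [hsum, Q.map_id, Category.id_comp]

end LocalDecomposition

/-! ### Projective dimension in the quotient -/

namespace ExactStructure

variable {B : Type u} [Category.{v} B] [Preadditive B] [HasFiniteBiproducts B]

/-- A rigid cotorsion pair `(𝒞, 𝒦)` such that every object with local endomorphism ring lies in
`𝒦` or has a coresolution by two objects of `𝒞`. -/
structure IsCoresolving (E : ExactStructure B) (𝒞 𝒦 : ObjectProperty B) : Prop where
  decompositions : HasLocalDecompositions B
  enoughProjectives : E.EnoughProjectives
  cotorsion : E.IsCotorsionPair 𝒞 𝒦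
  rigid : E.IsRigid 𝒞
  exists_coresolution : ∀ F : B, HasLocalEnd F → ¬ 𝒦 F →
    ∃ (C₁ C₂ : B) (x : F ⟶ C₁) (d : C₁ ⟶ C₂), 𝒞 C₁ ∧ 𝒞 C₂ ∧ E.ses x d

namespace IsCoresolving

variable {E : ExactStructure B} {𝒞 𝒦 : ObjectProperty B} (hE : E.IsCoresolving 𝒞 𝒦)
  {A : Type u} [Category.{v} A] [Preadditive A] {Q : B ⥤ A} (hQ : IsQuotientFunctor 𝒦 Q)

include hE hQ

/-- Factorizations through a monomorphism of the quotient can be tested on syzygies. -/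
lemma exists_lift_of_mono {M N T : A} (m : M ⟶ N) [Mono m] (t : T ⟶ N)
    (h : ∀ (C : B) (p : E.ProjPres C), 𝒞 C → ∀ s : Q.obj p.syz ⟶ T, ∃ l, l ≫ m = s ≫ t) :
    ∃ l, l ≫ m = t := by
  refine hQ.exists_lift_of_local hE.decompositions m t fun F hF hF' s r _ => ?_
  obtain ⟨C₁, C₂, x, d, hC₁, hC₂, hs⟩ := hE.exists_coresolution F hF hF'
  obtain ⟨q₁⟩ := exists_projPres hE.enoughProjectives C₁
  obtain ⟨q₂⟩ := exists_projPres hE.enoughProjectives C₂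
  obtain ⟨i, hi⟩ := q₁.exists_represents q₂ d
  obtain ⟨δ, hδ⟩ := q₂.exists_isConnecting hs
  have := epi_map_connecting hE.cotorsion hE.rigid hQ hs hC₁ hC₂ hδ
  have hz := map_comp_connecting hE.cotorsion hE.rigid hQ hs hi hδ
  obtain ⟨l, hl⟩ := h C₂ q₂ hC₂ (Q.map δ ≫ s)
  -- The lift found on `ΩC₂` descends to `F`: it kills `Ωd` because `m` is mono.
  obtain ⟨k, hk⟩ := exists_desc_map_connecting hE.cotorsion hE.rigid hQ hs hC₁ hC₂ hi hδ l
    (by rw [← cancel_mono m, Category.assoc, hl, Category.assoc, reassoc_of% hz]; simp)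
  exact ⟨k, by rw [← cancel_epi (Q.map δ), reassoc_of% hk, hl, Category.assoc]⟩

/-- Summands of `T` are projective, so their covers by syzygies split; no monomorphism is needed to
descend the lift. -/
lemma exists_lift_of_projective {M N T : A} [Projective T] (m : M ⟶ N) (t : T ⟶ N)
    (h : ∀ (C : B) (p : E.ProjPres C), 𝒞 C → ∀ s : Q.obj p.syz ⟶ T, ∃ l, l ≫ m = s ≫ t) :
    ∃ l, l ≫ m = t := by
  refine hQ.exists_lift_of_local hE.decompositions m t fun F hF hF' s r hsr => ?_
  obtain ⟨C₁, C₂, x, d, hC₁, hC₂, hs⟩ := hE.exists_coresolution F hF hF'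
  obtain ⟨q₂⟩ := exists_projPres hE.enoughProjectives C₂
  obtain ⟨δ, hδ⟩ := q₂.exists_isConnecting hs
  have := epi_map_connecting hE.cotorsion hE.rigid hQ hs hC₁ hC₂ hδ
  have hF : Projective (Q.obj F) := (⟨s, r, hsr⟩ : Retract (Q.obj F) T).projective
  obtain ⟨l, hl⟩ := h C₂ q₂ hC₂ (Q.map δ ≫ s)
  refine ⟨Projective.factorThru (𝟙 _) (Q.map δ) ≫ l, ?_⟩
  rw [Category.assoc, hl]
  simp

lemma mono_of_syz {M N : A} (m : M ⟶ N)
    (h : ∀ (C : B) (p : E.ProjPres C), 𝒞 C → ∀ s : Q.obj p.syz ⟶ M, s ≫ m = 0 → s = 0) :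
    Mono m := by
  refine Preadditive.mono_of_cancel_zero _ fun {T} t ht => ?_
  -- Lifting `t` through the zero morphism is the same as showing `t = 0`, so the reduction to local
  -- objects applies.
  obtain ⟨l, hl⟩ := hQ.exists_lift_of_local hE.decompositions (0 : M ⟶ M) t
    fun F hF hF' s r _ => by
      obtain ⟨C₁, C₂, x, d, hC₁, hC₂, hs⟩ := hE.exists_coresolution F hF hF'
      obtain ⟨q₂⟩ := exists_projPres hE.enoughProjectives C₂
      obtain ⟨δ, hδ⟩ := q₂.exists_isConnecting hs
      have := epi_map_connecting hE.cotorsion hE.rigid hQ hs hC₁ hC₂ hδ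
      refine ⟨0, ?_⟩
      rw [← cancel_epi (Q.map δ), h C₂ q₂ hC₂ (Q.map δ ≫ s ≫ t) (by simp [ht])]
      simp
  rw [← hl, comp_zero]

/-- The projective dimension of `X` in the quotient is at most one if and only if `Ωx` vanishes in
the quotient, for any coresolution `x` of `X` by objects of `𝒞`. -/
theorem projDimLE_one_iff {X C₁ C₂ : B} (hX : ∀ Z : B, Nonempty (Retract Z X) → 𝒦 Z → IsZero Z)
    {x : X ⟶ C₁} {d : C₁ ⟶ C₂} (hC₁ : 𝒞 C₁) (hC₂ : 𝒞 C₂) (h : E.ses x d)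
    (p : E.ProjPres X) (q₁ : E.ProjPres C₁) {a : p.syz ⟶ q₁.syz} (ha : p.Represents q₁ x a) :
    ProjDimLE 1 (Q.obj X) ↔ Q.map a = 0 := by
  have hCK := hE.cotorsion
  have hr := hE.rigid
  have := hQ.additive
  obtain ⟨q₂⟩ := exists_projPres hE.enoughProjectives C₂
  obtain ⟨i, hi⟩ := q₁.exists_represents q₂ d
  obtain ⟨δ, hδ⟩ := q₂.exists_isConnecting h
  have := epi_map_connecting hCK hr hQ h hC₁ hC₂ hδ
  have := projective_map_syz hCK hr hQ hC₁ q₁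
  have := projective_map_syz hCK hr hQ hC₂ q₂
  have hiδ := map_comp_connecting hCK hr hQ h hi hδ
  have hdesc := fun T => exists_desc_map_connecting (T := T) hCK hr hQ h hC₁ hC₂ hi hδ
  have hlift := fun (C : B) (p : E.ProjPres C) (hC : 𝒞 C) =>
    exists_lift_map_of_comp_connecting hCK hr hQ h hi hδ hC p
  refine ⟨?_, fun h0 => ?_⟩
  · rintro ⟨Y, P, j, e, hs, hP, hY⟩
    have hY : Projective Y := hY
    have := hs.mono
    have := hs.epi
    -- Comparison of the two presentations: `u, v` on the middle terms, `α, β` on the left ones, and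
    -- a homotopy `γ` from `u ≫ v` to the identity. `ε` is the error on `ΩC₁`, killed by `Ωd`.
    obtain ⟨u, hu⟩ : ∃ u, u ≫ e = Q.map δ := ⟨_, Projective.factorThru_comp (Q.map δ) e⟩
    obtain ⟨v, hv⟩ : ∃ v, v ≫ Q.map δ = e := ⟨_, Projective.factorThru_comp e (Q.map δ)⟩
    obtain ⟨α, hα⟩ := hs.exists_lift (Q.map i ≫ u) (by rw [Category.assoc, hu, hiδ])
    obtain ⟨β, hβ⟩ := hE.exists_lift_of_projective hQ (Q.map i) (j ≫ v) fun C p hC s =>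
      hlift C p hC (s ≫ j ≫ v) (by rw [Category.assoc, Category.assoc, hv, hs.zero, comp_zero])
    obtain ⟨γ, hγ⟩ := hlift C₂ q₂ hC₂ (u ≫ v - 𝟙 _)
      (by rw [Preadditive.sub_comp, Category.assoc, hv, hu, Category.id_comp, sub_self])
    obtain ⟨ε, hε⟩ := hQ.exists_map_eq (𝟙 _ - (α ≫ β - Q.map i ≫ γ))
    have hεi : Q.map ε ≫ Q.map i = 0 := by
      have h1 : (α ≫ β) ≫ Q.map i = Q.map i ≫ u ≫ v := by
        rw [Category.assoc, hβ, reassoc_of% hα]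
      rw [hε, Preadditive.sub_comp, Preadditive.sub_comp, h1, Category.assoc, hγ,
        Preadditive.comp_sub]
      simp
    have hai : Q.map a ≫ Q.map i = 0 := by
      have hz : p.Represents q₂ (x ≫ d) 0 := by
        rw [(E.weak h).zero]
        exact ⟨0, by simp, by simp⟩
      obtain ⟨t, ht⟩ := (ha.comp hi).sub_factors hz
      rw [sub_zero] at ht
      rw [← Q.map_comp, ht]
      exact hQ.map_eq_zero (hCK.left_le_right hr (hCK.proj_le_left p.projective)) _ _
    -- Here `j` being mono, i.e. the length-one resolution, is used.
    have haα : Q.map a ≫ α = 0 := by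
      rw [← cancel_mono j, Category.assoc, hα, reassoc_of% hai, zero_comp, zero_comp]
    have haε : Q.map a ≫ Q.map ε = Q.map a := by
      rw [hε, Preadditive.comp_sub, Preadditive.comp_sub, reassoc_of% haα, reassoc_of% hai]
      simp
    obtain ⟨g, hg⟩ := exists_represents_comp hCK hr hQ h hi hC₁ q₁ ε hεi
    have hiso : IsIso (𝟙 X - x ≫ g) :=
      isIso_one_sub_of_mem_factorSet hE.decompositions hCK.right_summands hX
        ⟨C₁, x, g, hCK.left_le_right hr hC₁, rfl⟩
    obtain ⟨w, hw⟩ := p.exists_represents p (inv (𝟙 X - x ≫ g))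
    have hx : inv (𝟙 X - x ≫ g) ≫ (x - x ≫ g ≫ x) = x := by
      have : x - x ≫ g ≫ x = (𝟙 X - x ≫ g) ≫ x := by simp [Preadditive.sub_comp]
      rw [this, IsIso.inv_hom_id_assoc]
    -- `Ωx` is also represented by `w ≫ (a - a ≫ ε)`, which vanishes in the quotient since `a ≫ ε`
    -- and `a` agree there.
    obtain ⟨t, ht⟩ := (hx ▸ hw.comp (ha.sub (ha.comp hg))).sub_factors ha
    have := hQ.map_eq_of_sub
      ⟨p.P, p.ι, t, hCK.left_le_right hr (hCK.proj_le_left p.projective), ht.symm⟩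
    rw [← this, Q.map_comp, Q.map_sub, Q.map_comp, haε, sub_self, comp_zero]
  · have : Mono (Q.map i) := hE.mono_of_syz hQ _ fun C p' hC s hs =>
      eq_zero_of_comp_map_eq_zero hCK hr hQ h hi ha h0 hC p' s hs
    refine ⟨_, _, Q.map i, Q.map δ, ?_, inferInstance, (inferInstance : Projective _)⟩
    refine IsWeakShortExact.of_exists_lift_desc hiδ (fun T f hf => ?_) fun T f hf => hdesc T f hf
    exact hE.exists_lift_of_mono hQ _ _ fun C p' hC s =>
      hlift C p' hC (s ≫ f) (by rw [Category.assoc, hf, comp_zero])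

end IsCoresolving

end ExactStructure

/-! ### Duality -/

section Opposite

variable {B : Type u} [Category.{v} B] [Preadditive B]

lemma HasLocalEnd.unop {F : Bᵒᵖ} (h : HasLocalEnd F) : HasLocalEnd F.unop := by
  refine ⟨fun h0 => h.1 (Quiver.Hom.unop_inj h0), fun f => ?_⟩
  rcases h.2 f.op with hf | hf
  · exact .inl ((isIso_op_iff f).1 hf)
  · exact .inr ((isIso_op_iff (𝟙 F.unop - f)).1 hf)

lemma HasLocalEnd.op {F : B} (h : HasLocalEnd F) : HasLocalEnd (Opposite.op F) := by
  refine ⟨fun h0 => h.1 (Quiver.Hom.op_inj h0), fun f => ?_⟩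
  rcases h.2 f.unop with hf | hf
  · exact .inl ((isIso_unop_iff f).1 hf)
  · exact .inr ((isIso_unop_iff (𝟙 (Opposite.op F) - f)).1 hf)

lemma HasLocalDecompositions.op (h : HasLocalDecompositions B) : HasLocalDecompositions Bᵒᵖ := by
  intro X
  obtain ⟨n, F, ι, π, hF, hιπ, hsum⟩ := h X.unop
  refine ⟨n, fun j => Opposite.op (F j), fun j => (π j).op, fun j => (ι j).op, fun j => (hF j).op,
    fun j => Quiver.Hom.unop_inj (hιπ j), Quiver.Hom.unop_inj ?_⟩
  rw [unop_sum]
  exact hsum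

lemma IsQuotientFunctor.op {W : ObjectProperty B} {A : Type u} [Category.{v} A] [Preadditive A]
    {Q : B ⥤ A} (hQ : IsQuotientFunctor W Q) : IsQuotientFunctor W.op Q.op where
  obj_surjective T := by
    obtain ⟨X, hX⟩ := hQ.obj_surjective T.unop
    exact ⟨Opposite.op X, congrArg Opposite.op hX⟩
  full := by
    have := hQ.full
    infer_instance
  additive := by
    have := hQ.additive
    infer_instance
  map_eq_zero_iff {X Y} f := by
    have h1 : Q.op.map f = 0 ↔ Q.map f.unop = 0 :=
      ⟨fun h => Quiver.Hom.op_inj h, fun h => Quiver.Hom.unop_inj h⟩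
    rw [h1, hQ.map_eq_zero_iff]
    constructor
    · rintro ⟨Z, a, b, hZ, h⟩
      exact ⟨Opposite.op Z, b.op, a.op, hZ, Quiver.Hom.unop_inj h⟩
    · rintro ⟨Z, a, b, hZ, h⟩
      exact ⟨Z.unop, b.unop, a.unop, hZ, Quiver.Hom.op_inj h⟩

lemma isStableUnderRetracts_op {B : Type u} [Category.{v} B] {W : ObjectProperty B}
    (h : W.IsStableUnderRetracts) : W.op.IsStableUnderRetracts where
  of_retract r hY := h.of_retract ⟨r.r.unop, r.i.unop, Quiver.Hom.op_inj r.retract⟩ hY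

lemma injDimLE_one_iff_op {A : Type u} [Category.{v} A] [Preadditive A] (X : A) :
    InjDimLE 1 X ↔ ProjDimLE 1 (Opposite.op X) := by
  constructor
  · rintro ⟨I, Y, i, d, h, hI, hY⟩
    have hY : Injective Y := hY
    exact ⟨Opposite.op Y, Opposite.op I, d.op, i.op, h.op, inferInstance,
      (inferInstance : Projective _)⟩
  · rintro ⟨Y, P, i, d, h, hP, hY⟩
    have hY : Projective Y := hY
    exact ⟨P.unop, Y.unop, d.unop, i.unop, h.unop, inferInstance, (inferInstance : Injective _)⟩

variable [HasFiniteBiproducts B]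

instance hasFiniteBiproducts_opposite : HasFiniteBiproducts Bᵒᵖ :=
  HasFiniteBiproducts.of_hasFiniteProducts

/-- Biproducts in the opposite category. -/
noncomputable def unopBiprodIso (X Y : Bᵒᵖ) : X.unop ⊞ Y.unop ≅ (X ⊞ Y).unop where
  hom := biprod.desc (biprod.fst : X ⊞ Y ⟶ X).unop (biprod.snd : X ⊞ Y ⟶ Y).unop
  inv := biprod.lift (biprod.inl : X ⟶ X ⊞ Y).unop (biprod.inr : Y ⟶ X ⊞ Y).unop
  hom_inv_id := by
    ext <;> simp [← unop_comp]
  inv_hom_id := by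
    rw [biprod.lift_desc, ← unop_comp, ← unop_comp, ← unop_add, biprod.total, unop_id]

lemma map_comp_unopBiprodIso_hom {X X' Y Y' : Bᵒᵖ} (a : X ⟶ Y) (b : X' ⟶ Y') :
    biprod.map a.unop b.unop ≫ (unopBiprodIso X X').hom =
      (unopBiprodIso Y Y').hom ≫ (biprod.map a b).unop := by
  ext <;> simp [unopBiprodIso, ← unop_comp]

namespace ExactStructure

/-- The opposite exact structure. -/
def op (E : ExactStructure B) : ExactStructure Bᵒᵖ where
  ses _ _ _ i d := E.ses d.unop i.unop
  weak h := (E.weak h).op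
  ses_of_iso {X Y Z X' Y' Z' i d i' d'} a b c h1 h2 h := by
    refine E.ses_of_iso c.unop.symm b.unop.symm a.unop.symm ?_ ?_ h
    · have : b.inv ≫ d = d' ≫ c.inv := by
        rw [Iso.inv_comp_eq, ← Category.assoc, Iso.eq_comp_inv, h2]
      exact congrArg Quiver.Hom.unop this
    · have : a.inv ≫ i = i' ≫ b.inv := by
        rw [Iso.inv_comp_eq, ← Category.assoc, Iso.eq_comp_inv, h1]
      exact congrArg Quiver.Hom.unop this
  ses_biprod h h' := E.ses_of_iso (unopBiprodIso _ _) (unopBiprodIso _ _) (unopBiprodIso _ _)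
    (map_comp_unopBiprodIso_hom _ _) (map_comp_unopBiprodIso_hom _ _) (E.ses_biprod h h')
  ses_of_biprod {X Y Z X' Y' Z' i d i' d'} h := by
    refine E.ses_of_biprod (i' := d'.unop) (d' := i'.unop) (E.ses_of_iso (unopBiprodIso _ _).symm
      (unopBiprodIso _ _).symm (unopBiprodIso _ _).symm ?_ ?_ h)
    · rw [Iso.symm_hom, Iso.symm_hom, Iso.eq_inv_comp, ← Category.assoc, ← map_comp_unopBiprodIso_hom]
      simp
    · rw [Iso.symm_hom, Iso.symm_hom, Iso.eq_inv_comp, ← Category.assoc, ← map_comp_unopBiprodIso_hom]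
      simp
  id_inflation X := by
    obtain ⟨Z, d, h⟩ := E.id_deflation X.unop
    exact ⟨Opposite.op Z, d.op, h⟩
  id_deflation X := by
    obtain ⟨Z, d, h⟩ := E.id_inflation X.unop
    exact ⟨Opposite.op Z, d.op, h⟩
  comp_inflation := by
    rintro X Y Z f g ⟨S, s, hs⟩ ⟨T, t, ht⟩
    obtain ⟨W, w, h⟩ := E.comp_deflation g.unop f.unop ⟨_, _, ht⟩ ⟨_, _, hs⟩
    exact ⟨Opposite.op W, w.op, h⟩
  comp_deflation := by
    rintro X Y Z f g ⟨S, s, hs⟩ ⟨T, t, ht⟩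
    obtain ⟨W, w, h⟩ := E.comp_inflation g.unop f.unop ⟨_, _, ht⟩ ⟨_, _, hs⟩
    exact ⟨Opposite.op W, w.op, h⟩
  exists_pullback f h := by
    obtain ⟨Y', g', i', sq, Z, d, hd⟩ := E.exists_pushout f.unop h
    exact ⟨Opposite.op Y', g'.op, i'.op, sq.op.flip, Opposite.op Z, d.op, hd⟩
  exists_pushout g h := by
    obtain ⟨Y', f', d', sq, Z, i, hi⟩ := E.exists_pullback g.unop h
    exact ⟨Opposite.op Y', f'.op, d'.op, sq.op.flip, Opposite.op Z, i.op, hi⟩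

variable {E : ExactStructure B}

lemma proj_op {I : B} (hI : E.inj I) : E.op.proj (Opposite.op I) := by
  rintro Y Z d ⟨X, i, h⟩ f
  obtain ⟨g, hg⟩ := hI d.unop ⟨_, _, h⟩ f.unop
  exact ⟨g.op, Quiver.Hom.unop_inj hg⟩

lemma EnoughInjectives.op (h : E.EnoughInjectives) : E.op.EnoughProjectives := fun X => by
  obtain ⟨I, i, hI, Z, d, hs⟩ := h X.unop
  exact ⟨Opposite.op I, i.op, proj_op hI, Opposite.op Z, d.op, hs⟩

lemma Ext1Vanishes.op {𝒰 𝒱 : ObjectProperty B} (h : E.Ext1Vanishes 𝒰 𝒱) :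
    E.op.Ext1Vanishes 𝒱.op 𝒰.op := fun U Y V i d hU hV hs => by
  obtain ⟨r, hr⟩ := h.exists_extension hs hU hV (𝟙 _)
  exact ⟨r.op, Quiver.Hom.unop_inj hr⟩

lemma IsCotorsionPair.op {𝒰 𝒱 : ObjectProperty B} (h : E.IsCotorsionPair 𝒰 𝒱) :
    E.op.IsCotorsionPair 𝒱.op 𝒰.op where
  left_summands := isStableUnderRetracts_op h.right_summands
  right_summands := isStableUnderRetracts_op h.left_summands
  ext := h.ext.op
  left_approx X := by
    obtain ⟨V, U, i, d, hV, hU, hs⟩ := h.right_approx X.unop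
    exact ⟨Opposite.op U, Opposite.op V, d.op, i.op, hU, hV, hs⟩
  right_approx X := by
    obtain ⟨V, U, i, d, hV, hU, hs⟩ := h.left_approx X.unop
    exact ⟨Opposite.op U, Opposite.op V, d.op, i.op, hU, hV, hs⟩

/-- An injective presentation as a projective presentation in the opposite category. -/
def InjPres.op {X : B} (p : E.InjPres X) : E.op.ProjPres (Opposite.op X) where
  syz := Opposite.op p.cosyz
  P := Opposite.op p.I
  ι := p.π.op
  π := p.ι.op
  projective := proj_op p.injective
  ses := p.ses

lemma InjPres.Represents.op {X Y : B} {p : E.InjPres X} {q : E.InjPres Y} {f : X ⟶ Y}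
    {c : p.cosyz ⟶ q.cosyz} (h : p.Represents q f c) : q.op.Represents p.op f.op c.op := by
  obtain ⟨b, h1, h2⟩ := h
  exact ⟨b.op, Quiver.Hom.unop_inj h2, Quiver.Hom.unop_inj h1⟩

end ExactStructure

end Opposite

/-! ### Resolutions by the right-hand class of a second cotorsion pair -/

lemma isQuotientFunctor_toIdealQuotient {B : Type u} [Category.{v} B] [Preadditive B]
    {W : ObjectProperty B}
    (hW : ∀ {X Y : B} (f : X ⟶ Y), f ∈ factorIdeal W X Y ↔ f ∈ factorSet W X Y) :
    IsQuotientFunctor W (toIdealQuotient W) where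
  obj_surjective T := ⟨T.as, rfl⟩
  full := inferInstance
  additive := ⟨rfl⟩
  map_eq_zero_iff f := by rw [toIdealQuotient_map_eq_zero_iff, hW]

namespace ExactStructure

variable {B : Type u} [Category.{v} B] [Preadditive B] [HasFiniteBiproducts B]
  {E : ExactStructure B} {𝒞 𝒦 𝒟 : ObjectProperty B}

lemma IsFullyRigid.isCoresolving (hB : IsKrullSchmidt B) (hP : E.EnoughProjectives)
    (h : E.IsFullyRigid 𝒞 𝒦) : E.IsCoresolving 𝒞 𝒦 where
  decompositions := hB.hasLocalDecompositions
  enoughProjectives := hP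
  cotorsion := h.cotorsion
  rigid := h.rigid
  exists_coresolution F hF hK := by
    obtain ⟨-, V, U, x, d, hV, hU, hs⟩ := (h.indecomposable F hF.indecomposable).resolve_left hK
    exact ⟨V, U, x, d, hV.1, hU, hs⟩

/-- If `k : K ⟶ X` is a deflation and `α : K ⟶ M` an inflation, then the morphism from `M` to the
pushout is a deflation with the same kernel as `k`. -/
lemma ses_of_isPushout {D K X M M' N : B} {i : D ⟶ K} {k : K ⟶ X} {α : K ⟶ M} {β : M ⟶ N}
    (h : E.ses i k) (hα : E.ses α β) {ε : M ⟶ M'} {a : X ⟶ M'} (sq : IsPushout α k ε a) :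
    E.ses (i ≫ α) ε := by
  obtain ⟨Z, e, he⟩ := E.comp_inflation i α ⟨_, _, h⟩ ⟨_, _, hα⟩
  have w := E.weak h
  have we := E.weak he
  have := w.epi
  have : Epi ε := by
    refine Preadditive.epi_of_cancel_zero _ fun f hf => sq.hom_ext (by rw [hf, comp_zero]) ?_
    rw [← cancel_epi k, ← reassoc_of% sq.w, hf]
    simp
  have key : ∀ (T : B) (f : M ⟶ T), (i ≫ α) ≫ f = 0 → ∃ l, ε ≫ l = f := fun T f hf => by
    obtain ⟨l, hl⟩ := w.exists_desc (α ≫ f) (by rw [← Category.assoc, hf])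
    exact ⟨sq.desc f l hl.symm, sq.inl_desc _ _ _⟩
  have hz : (i ≫ α) ≫ ε = 0 := by rw [Category.assoc, sq.w, reassoc_of% w.zero, zero_comp]
  have := we.mono
  refine ses_of_isWeakShortExact_right he (.of_exists_lift_desc hz (fun T f hf => ?_) key)
  obtain ⟨l, hl⟩ := key _ e we.zero
  exact we.exists_lift f (by rw [← hl, reassoc_of% hf, zero_comp])

/-- Every `𝒦`-approximation of an object without summands in `𝒦` has its middle term in `𝒟`. -/
lemma IsCoresolving.right_of_approx (hE : E.IsCoresolving 𝒞 𝒦) (hKD : E.IsCotorsionPair 𝒦 𝒟)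
    {X : B} (hX : ∀ Z : B, Nonempty (Retract Z X) → 𝒦 Z → IsZero Z) {D K : B} {i : D ⟶ K}
    {k : K ⟶ X} (hD : 𝒟 D) (hK : 𝒦 K) (h : E.ses i k) : 𝒟 K := by
  have hQ := isQuotientFunctor_toIdealQuotient hE.cotorsion.mem_factorIdeal_right
  set Q := toIdealQuotient 𝒦
  refine hKD.right_of_splits fun M N α β hN hs => ?_
  obtain ⟨M', ε, a, b, sq, hb, hs'⟩ := exists_pushout_ses k hs
  have hε := ses_of_isPushout h hs sq
  have w := E.weak hs
  have w' := E.weak hs'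
  have := w'.mono
  -- If `t ≫ a` factors through `L` in `𝒦`, the map `L ⟶ M'` lifts to `M`, as `ε` has kernel `D` in
  -- `𝒟`. The resulting map into `M` lands in `K`, so `t` factors through `k`.
  have : Mono (Q.map a) := by
    refine Preadditive.mono_of_cancel_zero _ fun {T} t ht => ?_
    obtain ⟨T, rfl⟩ := hQ.obj_surjective T
    obtain ⟨t, rfl⟩ := hQ.exists_map_eq t
    rw [← Q.map_comp, hQ.map_eq_zero_iff] at ht
    obtain ⟨L, c, e, hL, hce⟩ := ht
    obtain ⟨f, hf⟩ := hKD.ext.exists_lift hε hL hD e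
    obtain ⟨s, hs⟩ := w.exists_lift (c ≫ f)
      (by rw [← hb, Category.assoc, reassoc_of% hf, reassoc_of% hce, w'.zero, comp_zero])
    have : t = s ≫ k := by
      rw [← cancel_mono a, ← hce, ← hf, ← reassoc_of% hs, sq.w, Category.assoc]
    rw [this]
    exact hQ.map_eq_zero hK _ _
  -- In the quotient each `ΩC ⟶ M'` lifts to `X`: its composite to `N` in `𝒦` extends over `P`, and
  -- this extension lifts to `M'`. Hence `a` becomes invertible.
  obtain ⟨ρ, hρ⟩ := hE.exists_lift_of_mono hQ (Q.map a) (𝟙 _) fun C p hC s => by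
    obtain ⟨s, rfl⟩ := hQ.exists_map_eq s
    obtain ⟨t, ht⟩ := hE.cotorsion.ext.exists_extension p.ses hC hN (s ≫ b)
    obtain ⟨f, hf⟩ := p.projective b ⟨_, _, hs'⟩ t
    obtain ⟨l, hl⟩ := w'.exists_lift (s - p.ι ≫ f)
      (by rw [Preadditive.sub_comp, Category.assoc, hf, ht, sub_self])
    refine ⟨Q.map l, ?_⟩
    rw [Category.comp_id, ← Q.map_comp]
    refine (hQ.map_eq_of_sub ⟨p.P, p.ι, f, ?_, by rw [hl, sub_sub_cancel]⟩).symm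
    exact hE.cotorsion.left_le_right hE.rigid (hE.cotorsion.proj_le_left p.projective)
  obtain ⟨ρ, rfl⟩ := hQ.exists_map_eq ρ
  have haρ : Q.map (𝟙 X) = Q.map (a ≫ ρ) := by
    rw [← cancel_mono (Q.map a), Q.map_comp, Category.assoc, hρ]
    simp
  have := hQ.additive
  have hiso : IsIso (𝟙 X - (𝟙 X - a ≫ ρ)) :=
    isIso_one_sub_of_mem_factorSet hE.decompositions hE.cotorsion.right_summands hX
      ((hQ.map_eq_zero_iff _).1 (by rw [Q.map_sub, haρ, sub_self]))
  rw [sub_sub_cancel] at hiso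
  -- `X ↣ M' ↠ N` thus splits in the original category; the section `N ⟶ M'` lifts to `M` because
  -- Ext¹(N, D) = 0.
  obtain ⟨s, hs⟩ := w'.exists_section (ρ ≫ inv (a ≫ ρ))
    (by rw [← Category.assoc, IsIso.hom_inv_id])
  obtain ⟨s', hs''⟩ := hKD.ext.exists_lift hε hN hD s
  exact w.exists_retraction s' (by rw [← hb, reassoc_of% hs'', hs])

/-- The dual of a coresolving pair `(𝒞, 𝒦)`, if `(𝒦, 𝒟)` is a cotorsion pair. -/
lemma IsCoresolving.op (hE : E.IsCoresolving 𝒞 𝒦) (hI : E.EnoughInjectives)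
    (hKD : E.IsCotorsionPair 𝒦 𝒟) : E.op.IsCoresolving 𝒟.op 𝒦.op where
  decompositions := hE.decompositions.op
  enoughProjectives := hI.op
  cotorsion := hKD.op
  rigid := by
    refine Ext1Vanishes.op fun V Y U i d hV hU hs => hKD.ext i d hV ?_ hs
    -- `𝒟 ⊆ 𝒦`, since `𝒟` is Ext-orthogonal to `𝒦 ⊇ 𝒞`; hence `𝒟` is rigid.
    refine hE.cotorsion.right_of_splits fun Y C i d hC hs => ?_
    exact hKD.ext.exists_extension hs (hE.cotorsion.left_le_right hE.rigid hC) hU (𝟙 _)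
  exists_coresolution F hF hK := by
    obtain ⟨D, K, i, k, hD, hK', hs⟩ := hKD.left_approx F.unop
    refine ⟨Opposite.op K, Opposite.op D, k.op, i.op,
      hE.right_of_approx hKD (fun Z ⟨r⟩ hZ => ?_) hD hK' hs, hD, hs⟩
    -- A nonzero summand of a local object is the whole object, which is not in `𝒦`.
    refine (hF.unop.isZero_or_isIso_of_retract r).resolve_right fun hiso => hK ?_
    have := hE.cotorsion.right_summands
    exact this.of_retract (Retract.ofIso (asIso r.i).symm) hZ

end ExactStructure

theorem mainTheorem1 {B : Type u} [Category.{v} B] [Preadditive B] [HasFiniteBiproducts B]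
    (E : ExactStructure B) (hB : IsKrullSchmidt B)
    (hP : E.EnoughProjectives) (hI : E.EnoughInjectives)
    (𝒞 𝒦 𝒟 : ObjectProperty B)
    (hCK : E.IsFullyRigid 𝒞 𝒦) (hKD : E.IsCotorsionPair 𝒦 𝒟)
    (X : B) (hX : noSummandIn (E.heart 𝒞 𝒦) 𝒦 X) :
    ((∃ (C₁ C₂ : B) (x : X ⟶ C₁) (d : C₁ ⟶ C₂), 𝒞 C₁ ∧ 𝒞 C₂ ∧ E.ses x d) ∧
      ∀ (C₁ C₂ : B) (x : X ⟶ C₁) (d : C₁ ⟶ C₂), 𝒞 C₁ → 𝒞 C₂ → E.ses x d →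
        ∀ (p : E.ProjPres X) (q : E.ProjPres C₁) (ωx : p.syz ⟶ q.syz), p.Represents q x ωx →
          (ProjDimLE 1 ((toIdealQuotient 𝒦).obj X) ↔ (toIdealQuotient 𝒦).map ωx = 0)) ∧
    ((∃ (D₂ D₁ : B) (i : D₂ ⟶ D₁) (y : D₁ ⟶ X), 𝒟 D₂ ∧ 𝒟 D₁ ∧ E.ses i y) ∧
      ∀ (D₂ D₁ : B) (i : D₂ ⟶ D₁) (y : D₁ ⟶ X), 𝒟 D₂ → 𝒟 D₁ → E.ses i y →
        ∀ (p : E.InjPres D₁) (q : E.InjPres X) (σy : p.cosyz ⟶ q.cosyz), p.Represents q y σy →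
          (InjDimLE 1 ((toIdealQuotient 𝒦).obj X) ↔ (toIdealQuotient 𝒦).map σy = 0)) := by
  have hE := hCK.isCoresolving hB hP
  have hQ := isQuotientFunctor_toIdealQuotient hE.cotorsion.mem_factorIdeal_right
  obtain ⟨⟨-, V, U, x, d, hV, hU, hs⟩, hX⟩ := hX
  refine ⟨⟨⟨V, U, x, d, hV.1, hU, hs⟩, fun C₁ C₂ x d hC₁ hC₂ hs p q a ha =>
    hE.projDimLE_one_iff hQ hX hC₁ hC₂ hs p q ha⟩, ?_, ?_⟩
  · obtain ⟨D, K, i, k, hD, hK, hs⟩ := hKD.left_approx X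
    exact ⟨D, K, i, k, hD, hE.right_of_approx hKD hX hD hK hs, hs⟩
  · intro D₂ D₁ i y hD₂ hD₁ hs p q σ hσ
    have h := (hE.op hI hKD).projDimLE_one_iff hQ.op (X := Opposite.op X) (x := y.op) (d := i.op)
      (fun Z ⟨r⟩ hZ =>
        (hX Z.unop ⟨⟨r.r.unop, r.i.unop, Quiver.Hom.op_inj r.retract⟩⟩ hZ).op)
      hD₁ hD₂ hs q.op p.op hσ.op
    rw [injDimLE_one_iff_op]
    exact h.trans ⟨fun h => Quiver.Hom.op_inj h, fun h => Quiver.Hom.unop_inj h⟩
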